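/- **Setting.** Consider a discounted Markov decision process with finite state space $\mathcal S$, finite nonempty action space $\mathcal A$, transition probabilities $P(s'|s,a)$, rewards $r(s,a)\in[0,1]$ and discount factor $\gamma\in[0,1)$. For a policy $\pi=(\pi(\cdot|s))_{s}$ let $V^\pi(s)=\mathbb E[\sum_{t\ge 0}\gamma^t r(s_t,a_t)\mid s_0=s,\pi]$ and $Q^\pi(s,a)=\mathbb E[\sum_{t\ge 0}\gamma^t r(s_t,a_t)\mid s_0=s,a_0=a,\pi]$, and write $V^\pi(\rho)=\sum_s\rho(s)V^\pi(s)$ for a distribution $\rho$ on $\mathcal S$. Let $V^*=\max_\pi V^\pi$, $Q^*=\max_\pi Q^\pi$ (pointwise), $A^*(s,a)=Q^*(s,a)-V^*(s)$, $\mathcal A^*_s=\operatorname{argmax}_a A^*(s,a)$; a policy $\pi$ is optimal if $V^\pi(s)=V^*(s)$ for all $s$. Let $d^\pi_\rho(s)=(1-\gamma)\,\mathbb E[\sum_{t\ge0}\gamma^t\mathbf 1\{s_t=s\}\mid s_0\sim\rho,\pi]$. Let $\mu,\rho$ be distributions on $\mathcal S$ with $\tilde\mu=\min_s\mu(s)>0$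 and $\tilde\rho=\min_s\rho(s)>0$. Softmax policy gradient with constant step size $\eta>0$, started at an arbitrary $\theta^0\in\mathbb R^{|\mathcal S|\times|\mathcal A|}$, is the iteration $\theta^{k+1}=\theta^k+\eta\,\nabla_\theta V^{\pi_\theta}(\mu)\big|_{\theta=\theta^k}$, where $\pi_\theta(a|s)=\exp(\theta_{s,a})/\sum_{a'}\exp(\theta_{s,a'})$. Write $\pi^k=\pi_{\theta^k}$, $V^k=V^{\pi^k}$, and $b^k_s=\sum_{a\notin\mathcal A^*_s}\pi^k(a|s)$, and let $$\kappa=\inf_{k\ge 0,\ s\in\mathcal S}\,(1-b^k_s).$$ **Theorem (sublinear convergence for any constant step size).** For every constant step size $\eta>0$ one has $\kappa>0$, and for all $k\ge 1$ $$V^*(\rho)-V^k(\rho)\;\le\;\frac1k\,\frac{1}{\tilde\rho\,(1-\gamma)^3}\,\frac{|\mathcal A|}{\kappa^2}\Big(\max_s|\mathcal A^*_s|\Big)^2\Big(1+\frac{1-\gamma}{\eta\,\tilde\mu}\Big).$$ In particular, if the optimal policy $\pi^*$ is unique (equivalently, $|\mathcal A^*_s|=1$ for all $s$), then for all $k\ge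 1$ $$V^*(\rho)-V^k(\rho)\;\le\;\frac1k\,\frac{1}{(1-\gamma)^3}\,\frac{|\mathcal A|}{\kappa^2}\,\Big\|\frac{d^{\pi^*}_\rho}{\rho}\Big\|_\infty\Big(1+\frac{1-\gamma}{\eta\,\tilde\mu}\Big),$$ where $\|d^{\pi^*}_\rho/\rho\|_\infty=\max_s d^{\pi^*}_\rho(s)/\rho(s)$. -/

import Mathlib

open MeasureTheory ProbabilityTheory
open scoped BigOperators

noncomputable section

/-! ### Trajectories of a finite Markov chain

`stdSimplex ℝ Z` is the set `Δ(Z)` of probability vectors on a finite type `Z`. -/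

section Trajectories

variable {Z : Type*} [Fintype Z]

/-- The probability measure with mass `p z` at each point `z`. -/
def simplexMeasure [MeasurableSpace Z] (p : stdSimplex ℝ Z) : Measure Z :=
  ∑ z, ENNReal.ofReal (p z) • Measure.dirac z

instance simplexMeasure_isProbabilityMeasure [MeasurableSpace Z] (p : stdSimplex ℝ Z) :
    IsProbabilityMeasure (simplexMeasure p) := by
  constructor
  simp only [simplexMeasure, Measure.coe_finsetSum, Finset.sum_apply, Measure.smul_apply,
    measure_univ, smul_eq_mul, mul_one]
  rw [← ENNReal.ofReal_sum_of_nonneg (fun z _ => stdSimplex.zero_le p z)]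
  simp

/-- The one-step kernel of a time-homogeneous Markov chain with transition probabilities
`K z z'`, seen as a kernel from the history up to time `n` to the state at time `n + 1`. -/
def chainKernel [MeasurableSpace Z] [DiscreteMeasurableSpace Z] (K : Z → stdSimplex ℝ Z) (n : ℕ) :
    Kernel ((i : Finset.Iic n) → (fun _ : ℕ => Z) i) Z :=
  (Kernel.ofFunOfCountable fun z => simplexMeasure (K z)).comap
    (fun x => x ⟨n, Finset.mem_Iic.2 le_rfl⟩) (measurable_pi_apply _)

instance chainKernel_isMarkovKernel [MeasurableSpace Z] [DiscreteMeasurableSpace Z]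
    (K : Z → stdSimplex ℝ Z) (n : ℕ) : IsMarkovKernel (chainKernel K n) :=
  ⟨fun x => simplexMeasure_isProbabilityMeasure (K (x ⟨n, Finset.mem_Iic.2 le_rfl⟩))⟩

/-- The law, on the space of infinite trajectories, of the Markov chain with initial
distribution `p₀` and transition probabilities `K`. -/
def chainLaw [MeasurableSpace Z] [DiscreteMeasurableSpace Z] (p₀ : stdSimplex ℝ Z)
    (K : Z → stdSimplex ℝ Z) : Measure (ℕ → Z) :=
  Kernel.trajMeasure (X := fun _ : ℕ => Z) (simplexMeasure p₀) (chainKernel K)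

/-- Expectation of a functional `f` of the trajectory of the Markov chain with initial
distribution `p₀` and transition probabilities `K`; the finite state space is discrete. -/
def chainExp (p₀ : stdSimplex ℝ Z) (K : Z → stdSimplex ℝ Z) (f : (ℕ → Z) → ℝ) : ℝ :=
  letI : MeasurableSpace Z := ⊤
  haveI : DiscreteMeasurableSpace Z := ⟨fun _ => trivial⟩
  ∫ ω, f ω ∂(chainLaw p₀ K)

end Trajectories

/-! ### Finite discounted Markov decision processes -/

/-- A Markov decision process with state space `S`, action space `A`, transition probabilities
`P s a s' = P(s'|s,a)`, rewards `r s a ∈ [0,1]` and discount factor `γ ∈ [0,1)`. -/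
structure FiniteMDP (S A : Type*) [Fintype S] [Fintype A] where
  P : S → A → stdSimplex ℝ S
  r : S → A → ℝ
  γ : ℝ
  r_mem : ∀ s a, r s a ∈ Set.Icc (0 : ℝ) 1
  γ_mem : γ ∈ Set.Ico (0 : ℝ) 1

/-- A policy assigns to each state a probability vector on actions: `π s a = π(a|s)`. -/
abbrev Policy (S A : Type*) [Fintype A] : Type _ := S → stdSimplex ℝ A

/-- The law of `(s, a)` with `s ∼ ρ` and `a ∼ π(·|s)`. -/
def stateActionLaw {S A : Type*} [Fintype S] [Fintype A] (ρ : stdSimplex ℝ S) (π : Policy S A) :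
    stdSimplex ℝ (S × A) :=
  ⟨fun z => ρ z.1 * π z.1 z.2, fun z => mul_nonneg (ρ.2.1 z.1) ((π z.1).2.1 z.2), by
    simp [Fintype.sum_prod_type, ← Finset.mul_sum]⟩

namespace FiniteMDP

variable {S A : Type*} [Fintype S] [Fintype A] (M : FiniteMDP S A)

/-- Expectation over the trajectory `(s_0,a_0), (s_1,a_1), …` with `(s_0,a_0) ∼ p₀`,
`s_{t+1} ∼ P(·|s_t,a_t)` and `a_{t+1} ∼ π(·|s_{t+1})`. -/
def expect (π : Policy S A) (p₀ : stdSimplex ℝ (S × A)) (f : (ℕ → S × A) → ℝ) : ℝ :=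
  chainExp p₀ (fun z => stateActionLaw (M.P z.1 z.2) π) f

/-- The discounted cumulative reward of a trajectory. -/
def discountedReward (ω : ℕ → S × A) : ℝ := ∑' t, M.γ ^ t * M.r (ω t).1 (ω t).2

open Classical in
/-- State value `V^π(s)`: the trajectory starts at `s_0 = s`, with `a_0 ∼ π(·|s)`. -/
def V (π : Policy S A) (s : S) : ℝ :=
  M.expect π (stateActionLaw (stdSimplex.vertex s) π) M.discountedReward

open Classical in
/-- Action value `Q^π(s,a)`: the trajectory starts at `(s_0,a_0) = (s,a)`. -/
def Q (π : Policy S A) (s : S) (a : A) : ℝ :=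
  M.expect π (stdSimplex.vertex (s, a)) M.discountedReward

/-- `V^π(ρ) = E_{s∼ρ}[V^π(s)]`. -/
def Vavg (ρ : stdSimplex ℝ S) (π : Policy S A) : ℝ := ∑ s, ρ s * M.V π s

open Classical in
/-- The visitation measure
`d_ρ^π(s) = (1 - γ) E[∑_t γ^t 1{s_t = s} | s_0 ∼ ρ, π]`. -/
def visitation (ρ : stdSimplex ℝ S) (π : Policy S A) (s : S) : ℝ :=
  (1 - M.γ) * M.expect π (stateActionLaw ρ π)
    (fun ω => ∑' t, M.γ ^ t * if (ω t).1 = s then 1 else 0)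

/-- The optimal state value `V^*(s)`. -/
def Vstar (s : S) : ℝ := ⨆ π : Policy S A, M.V π s

/-- The optimal action value `Q^*(s,a)`. -/
def Qstar (s : S) (a : A) : ℝ := ⨆ π : Policy S A, M.Q π s a

/-- `A^*(s,a) = Q^*(s,a) - V^*(s)`. -/
def Astar (s : S) (a : A) : ℝ := M.Qstar s a - M.Vstar s

/-- `V^*(ρ) = E_{s∼ρ}[V^*(s)]`. -/
def VstarAvg (ρ : stdSimplex ℝ S) : ℝ := ∑ s, ρ s * M.Vstar s

/-- A policy is optimal if it attains the optimal value at every state. -/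
def IsOptimal (π : Policy S A) : Prop := ∀ s, M.V π s = M.Vstar s

open Classical in
/-- The optimal action set `argmax_a A^*(s,a)`. -/
def optActions (s : S) : Finset A :=
  Finset.univ.filter fun a => ∀ a', M.Astar s a' ≤ M.Astar s a

open Classical in
/-- `b_s^π`, the probability that `π` puts on non-optimal actions at `s`. -/
def nonoptProb (π : Policy S A) (s : S) : ℝ := ∑ a with a ∉ M.optActions s, π s a

/-- `max_s |A_s^*|`. -/
def maxOptActions : ℕ := Finset.univ.sup fun s => (M.optActions s).card

end FiniteMDP

/-! ### Softmax policy gradient -/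

section Softmax

variable {S A : Type*} [Fintype S] [Fintype A] [Nonempty A]

/-- The softmax policy `π_θ(a|s) = exp θ_{s,a} / ∑_{a'} exp θ_{s,a'}`. -/
def softmaxPolicy (θ : EuclideanSpace ℝ (S × A)) : Policy S A := fun s =>
  ⟨fun a => Real.exp (θ (s, a)) / ∑ a', Real.exp (θ (s, a')), fun a => by positivity, by
    rw [← Finset.sum_div]
    exact div_self (by positivity)⟩

/-- The parameters produced by softmax policy gradient with constant step size `η`, that is,
gradient ascent `θ^{k+1} = θ^k + η ∇_θ V^{π_θ}(μ)` from `θ^0 = θ₀`. -/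
def FiniteMDP.softmaxPG (M : FiniteMDP S A) (μ : stdSimplex ℝ S) (η : ℝ)
    (θ₀ : EuclideanSpace ℝ (S × A)) : ℕ → EuclideanSpace ℝ (S × A)
  | 0 => θ₀
  | k + 1 => FiniteMDP.softmaxPG M μ η θ₀ k +
      η • gradient (fun θ => M.Vavg μ (softmaxPolicy θ)) (FiniteMDP.softmaxPG M μ η θ₀ k)

/-- `κ = inf_{k,s} (1 - b_s^k)` for a sequence of policies `π^k`. -/
def FiniteMDP.kappa (M : FiniteMDP S A) (π : ℕ → Policy S A) : ℝ :=
  ⨅ z : ℕ × S, (1 - M.nonoptProb (π z.1) z.2)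

end Softmax

end

/-! Fix a state, and write p_a for π^k(a|s) and A_a for the advantage Q − V of π^k. The policy
gradient theorem shows that one step multiplies p_a by exp(h p_a A_a) and renormalises, where h = η
d(s)/(1−γ) and d is the visitation measure started from μ. Since d ≥ (1−γ)μ, the effective step h is
at least η min μ.

No smoothness of the value is used. Because Σ p_a A_a = 0 and x(e^{hx} − 1) ≥ 0 for all x, the new
policy has expected old advantage at least h y²/(1 + h/(1−γ)), where y = max_a p_a A_a, for every h
(`softmax_step_improvement`). By the performance difference lemma the value then rises by at least
this much at every state separately, which is why η is unrestricted and ρ may differ from μ.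

Conversely, π^k conditioned on the optimal actions is an optimal policy whose weights are at most
p_a/κ. Comparing π^k with it, and applying Cauchy–Schwarz to the visitation measure, bounds the
squared gap by a multiple of Σ ρ(s) y(s)² (`VstarAvg_sub_sq_le`). The two estimates give δ_{k+1} ≤
δ_k − c δ_k², hence δ_k ≤ 1/(ck).

That κ > 0 rests on global convergence (`tendsto_V_pgPolicy`). Values are monotone and bounded, so
advantages converge. If some limiting advantage were positive, the parameter of that action would
tend to infinity, while the zero mean of the advantages would force certain actions with larger
parameters to have bounded parameter sum (`softmax_dynamics_limit_nonpos`). So the limit satisfies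
the Bellman optimality inequality and equals V^*; the mass on non-optimal actions then tends to 0.
-/

noncomputable section

open Filter Topology

/-! ### Discounted expectations along a finite Markov chain. -/

section ChainExpectation

variable {Z : Type*} [Fintype Z]

/-- The one-step expectation operator `g ↦ (z ↦ ∑ z', K(z'|z) g(z'))`. -/
def chainOp (K : Z → stdSimplex ℝ Z) (g : Z → ℝ) (z : Z) : ℝ := ∑ z', K z z' * g z'

/-- The discounted sum `∑ t, γ ^ t K^t g`. -/
def chainValue (K : Z → stdSimplex ℝ Z) (γ : ℝ) (g : Z → ℝ) (z : Z) : ℝ :=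
  ∑' t : ℕ, γ ^ t * (chainOp K)^[t] g z

lemma chainOp_sub (K : Z → stdSimplex ℝ Z) (g h : Z → ℝ) (z : Z) :
    chainOp K (fun z => g z - h z) z = chainOp K g z - chainOp K h z := by
  simp [chainOp, mul_sub, Finset.sum_sub_distrib]

lemma chainOp_mul (K : Z → stdSimplex ℝ Z) (c : ℝ) (g : Z → ℝ) (z : Z) :
    chainOp K (fun z => c * g z) z = c * chainOp K g z := by
  simp only [chainOp, Finset.mul_sum]
  exact Finset.sum_congr rfl fun _ _ => by ring

lemma chainOp_const (K : Z → stdSimplex ℝ Z) (c : ℝ) (z : Z) :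
    chainOp K (fun _ => c) z = c := by
  simp [chainOp, ← Finset.sum_mul]

lemma chainOp_sum {ι : Type*} (K : Z → stdSimplex ℝ Z) (I : Finset ι) (g : ι → Z → ℝ) (z : Z) :
    chainOp K (fun z => ∑ i ∈ I, g i z) z = ∑ i ∈ I, chainOp K (g i) z := by
  simp only [chainOp, Finset.mul_sum]
  exact Finset.sum_comm

lemma chainOp_mono (K : Z → stdSimplex ℝ Z) {g h : Z → ℝ} (H : ∀ z, g z ≤ h z) (z : Z) :
    chainOp K g z ≤ chainOp K h z :=
  Finset.sum_le_sum fun z' _ => mul_le_mul_of_nonneg_left (H z') (stdSimplex.zero_le _ _)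

lemma abs_chainOp_le (K : Z → stdSimplex ℝ Z) {g : Z → ℝ} {B : ℝ} (H : ∀ z, |g z| ≤ B) (z : Z) :
    |chainOp K g z| ≤ B := by
  rw [abs_le]
  constructor
  · have := chainOp_mono K (g := fun _ => -B) (h := g) (fun z => (abs_le.1 (H z)).1) z
    rwa [chainOp_const] at this
  · have := chainOp_mono K (h := fun _ => B) (g := g) (fun z => (abs_le.1 (H z)).2) z
    rwa [chainOp_const] at this

lemma exists_abs_le (g : Z → ℝ) : ∃ B, ∀ z, |g z| ≤ B :=
  ⟨∑ z, |g z|, fun z =>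
    Finset.single_le_sum (f := fun z => |g z|) (fun _ _ => abs_nonneg _) (Finset.mem_univ z)⟩

lemma abs_iterate_chainOp_le (K : Z → stdSimplex ℝ Z) {g : Z → ℝ} {B : ℝ} (H : ∀ z, |g z| ≤ B)
    (t : ℕ) (z : Z) : |(chainOp K)^[t] g z| ≤ B := by
  induction t generalizing z with
  | zero => exact H z
  | succ t ih =>
    rw [Function.iterate_succ_apply']
    exact abs_chainOp_le K ih z

/-- Comparison principle: a function dominating its discounted one-step expectation is
nonnegative. -/
lemma nonneg_of_chainOp_le (K : Z → stdSimplex ℝ Z) {γ : ℝ} (hγ : γ ∈ Set.Ico (0 : ℝ) 1)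
    {u : Z → ℝ} (hu : ∀ z, γ * chainOp K u z ≤ u z) (z : Z) : 0 ≤ u z := by
  have : Nonempty Z := ⟨z⟩
  -- Minimum principle: at a minimiser m the average of u is at least u m, so γ u(m) ≤ u(m), and γ <
  -- 1 makes u(m) nonnegative.
  obtain ⟨m, hm⟩ := Finite.exists_min u
  have h1 : u m ≤ chainOp K u m := by
    have := chainOp_mono K (g := fun _ => u m) hm m
    rwa [chainOp_const] at this
  have h2 : γ * u m ≤ u m := (mul_le_mul_of_nonneg_left h1 hγ.1).trans (hu m)
  have h3 : 0 ≤ u m := by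
    have := hγ.2
    nlinarith
  exact h3.trans (hm z)

lemma summable_chainValue (K : Z → stdSimplex ℝ Z) {γ : ℝ} (hγ : γ ∈ Set.Ico (0 : ℝ) 1)
    (g : Z → ℝ) (z : Z) : Summable fun t : ℕ => γ ^ t * (chainOp K)^[t] g z := by
  obtain ⟨B, hB⟩ := exists_abs_le g
  refine Summable.of_norm_bounded ((summable_geometric_of_lt_one hγ.1 hγ.2).mul_right B) fun t => ?_
  rw [Real.norm_eq_abs, abs_mul, abs_of_nonneg (pow_nonneg hγ.1 t)]
  exact mul_le_mul_of_nonneg_left (abs_iterate_chainOp_le K hB t z) (pow_nonneg hγ.1 t)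

lemma chainValue_eq (K : Z → stdSimplex ℝ Z) {γ : ℝ} (hγ : γ ∈ Set.Ico (0 : ℝ) 1)
    (g : Z → ℝ) (z : Z) :
    chainValue K γ g z = g z + γ * chainOp K (chainValue K γ g) z := by
  have h1 : chainOp K (chainValue K γ g) z =
      ∑' t : ℕ, γ ^ t * (chainOp K)^[t + 1] g z := by
    simp only [chainOp, chainValue, Function.iterate_succ_apply']
    simp_rw [← tsum_mul_left]
    rw [← Summable.tsum_finsetSum fun z' _ => (summable_chainValue K hγ g z').mul_left _]
    refine tsum_congr fun t => ?_
    rw [Finset.mul_sum]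
    refine Finset.sum_congr rfl fun z' _ => ?_
    change K z z' * (γ ^ t * (chainOp K)^[t] g z') = γ ^ t * (K z z' * (chainOp K)^[t] g z')
    ring
  rw [h1, ← tsum_mul_left, chainValue, (summable_chainValue K hγ g z).tsum_eq_zero_add]
  simp only [pow_zero, one_mul, Function.iterate_zero, id]
  congr 1
  exact tsum_congr fun t => by ring

/-- The discounted sum is the only solution of its fixed-point equation. -/
lemma eq_chainValue (K : Z → stdSimplex ℝ Z) {γ : ℝ} (hγ : γ ∈ Set.Ico (0 : ℝ) 1)
    {g v : Z → ℝ} (hv : ∀ z, v z = g z + γ * chainOp K v z) (z : Z) :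
    v z = chainValue K γ g z := by
  -- The difference solves the homogeneous equation, so the comparison principle applies to it and
  -- to its negative.
  have key : ∀ z, v z - chainValue K γ g z =
      γ * chainOp K (fun z => v z - chainValue K γ g z) z := fun z => by
    rw [chainOp_sub, hv z, chainValue_eq K hγ g z, ← hv z]
    conv_lhs => rw [hv z]
    ring
  have h1 := nonneg_of_chainOp_le K hγ (fun z => (key z).ge) z
  have h2 := nonneg_of_chainOp_le K hγ (u := fun z => (-1) * (v z - chainValue K γ g z))
    (fun z => by rw [chainOp_mul, key z]; linarith) z
  linarith

lemma integral_simplexMeasure [MeasurableSpace Z] [DiscreteMeasurableSpace Z]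
    (p : stdSimplex ℝ Z) (g : Z → ℝ) : ∫ z, g z ∂(simplexMeasure p) = ∑ z, p z * g z := by
  rw [simplexMeasure, integral_finsetSum_measure]
  · refine Finset.sum_congr rfl fun z _ => ?_
    rw [integral_smul_measure, integral_dirac, ENNReal.toReal_ofReal (stdSimplex.zero_le p z),
      smul_eq_mul]
  · intro z _
    exact (integrable_dirac (by simp)).smul_measure ENNReal.ofReal_ne_top

lemma integrable_of_discrete {Ω : Type*} [MeasurableSpace Ω] [MeasurableSpace Z]
    [DiscreteMeasurableSpace Z] (P : Measure Ω) [IsFiniteMeasure P] {X : Ω → Z}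
    (hX : Measurable X) (g : Z → ℝ) : Integrable (fun ω => g (X ω)) P := by
  obtain ⟨B, hB⟩ := exists_abs_le g
  exact Integrable.of_bound ((Measurable.of_discrete (f := g)).comp hX).aestronglyMeasurable B
    (ae_of_all _ fun ω => hB _)

instance isProbabilityMeasure_chainLaw [MeasurableSpace Z] [DiscreteMeasurableSpace Z]
    (p₀ : stdSimplex ℝ Z) (K : Z → stdSimplex ℝ Z) : IsProbabilityMeasure (chainLaw p₀ K) := by
  unfold chainLaw
  infer_instance

/-- Markov property: the joint law of the history up to t and the next state is a
composition-product whose kernel reads only the last coordinate of the history. -/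
lemma integral_chainLaw_succ [MeasurableSpace Z] [DiscreteMeasurableSpace Z]
    (p₀ : stdSimplex ℝ Z) (K : Z → stdSimplex ℝ Z) (g : Z → ℝ) (t : ℕ) :
    ∫ ω, g (ω (t + 1)) ∂(chainLaw p₀ K) = ∫ ω, chainOp K g (ω t) ∂(chainLaw p₀ K) := by
  have h := Kernel.map_frestrictLe_trajMeasure_compProd_eq_map_trajMeasure
    (X := fun _ : ℕ => Z) (μ₀ := simplexMeasure p₀) (κ := chainKernel K) (a := t)
  change (chainLaw p₀ K).map _ ⊗ₘ _ = (chainLaw p₀ K).map _ at h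
  have hm : Measurable fun x : ℕ → Z =>
      (Preorder.frestrictLe (π := fun _ : ℕ => Z) t x, x (t + 1)) := by
    fun_prop
  have hg : Measurable fun y : ((i : Finset.Iic t) → (fun _ : ℕ => Z) i) × Z => g y.2 :=
    (Measurable.of_discrete (f := g)).comp measurable_snd
  have h1 : ∫ ω, g (ω (t + 1)) ∂(chainLaw p₀ K) =
      ∫ y, g y.2 ∂((chainLaw p₀ K).map
        (fun x => (Preorder.frestrictLe (π := fun _ : ℕ => Z) t x, x (t + 1)))) := by
    rw [integral_map hm.aemeasurable hg.aestronglyMeasurable]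
  have : IsProbabilityMeasure
      ((chainLaw p₀ K).map (Preorder.frestrictLe (π := fun _ : ℕ => Z) t)) :=
    Measure.isProbabilityMeasure_map (by fun_prop)
  rw [h1, ← h, Measure.integral_compProd (integrable_of_discrete _ measurable_snd g),
    integral_map (by fun_prop)]
  · refine integral_congr_ae (ae_of_all _ fun ω => ?_)
    exact integral_simplexMeasure (K (ω t)) g
  · have : (fun x : ((i : Finset.Iic t) → (fun _ : ℕ => Z) i) =>
        ∫ z, g z ∂(chainKernel K t x)) =
        fun x => chainOp K g (x ⟨t, Finset.mem_Iic.2 le_rfl⟩) := by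
      funext x
      exact integral_simplexMeasure _ g
    rw [this]
    exact ((Measurable.of_discrete (f := chainOp K g)).comp
      (measurable_pi_apply _)).aestronglyMeasurable

lemma integral_chainLaw_zero [MeasurableSpace Z] [DiscreteMeasurableSpace Z]
    (p₀ : stdSimplex ℝ Z) (K : Z → stdSimplex ℝ Z) (g : Z → ℝ) :
    ∫ ω, g (ω 0) ∂(chainLaw p₀ K) = ∑ z, p₀ z * g z := by
  have hg : Measurable fun x : ((i : Finset.Iic 0) → (fun _ : ℕ => Z) i) =>
      g (x ⟨0, Finset.mem_Iic.2 le_rfl⟩) :=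
    (Measurable.of_discrete (f := g)).comp (measurable_pi_apply _)
  have h1 : ∫ ω, g (ω 0) ∂(chainLaw p₀ K) =
      ∫ x, g (x ⟨0, Finset.mem_Iic.2 le_rfl⟩) ∂((chainLaw p₀ K).map
        (Preorder.frestrictLe (π := fun _ : ℕ => Z) 0)) := by
    rw [integral_map (by fun_prop) hg.aestronglyMeasurable]
    rfl
  rw [h1, chainLaw, Kernel.trajMeasure, Measure.map_comp _ _ (by fun_prop),
    Kernel.traj_map_frestrictLe, Kernel.partialTraj_self, Measure.id_comp,
    integral_map (by fun_prop) hg.aestronglyMeasurable, ← integral_simplexMeasure]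
  rfl

lemma integral_chainLaw [MeasurableSpace Z] [DiscreteMeasurableSpace Z]
    (p₀ : stdSimplex ℝ Z) (K : Z → stdSimplex ℝ Z) (g : Z → ℝ) (t : ℕ) :
    ∫ ω, g (ω t) ∂(chainLaw p₀ K) = ∑ z, p₀ z * (chainOp K)^[t] g z := by
  induction t generalizing g with
  | zero => exact integral_chainLaw_zero p₀ K g
  | succ t ih => rw [integral_chainLaw_succ, ih, Function.iterate_succ_apply]

/-- The expected discounted sum of a function of the current state. -/
lemma chainExp_discounted (p₀ : stdSimplex ℝ Z) (K : Z → stdSimplex ℝ Z) {γ : ℝ}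
    (hγ : γ ∈ Set.Ico (0 : ℝ) 1) (g : Z → ℝ) :
    chainExp p₀ K (fun ω => ∑' t : ℕ, γ ^ t * g (ω t)) = ∑ z, p₀ z * chainValue K γ g z := by
  let _ : MeasurableSpace Z := ⊤
  have : DiscreteMeasurableSpace Z := ⟨fun _ => trivial⟩
  change ∫ ω, (∑' t : ℕ, γ ^ t * g (ω t)) ∂(chainLaw p₀ K) = _
  obtain ⟨B, hB⟩ := exists_abs_le g
  have hint : ∀ t : ℕ, Integrable (fun ω : ℕ → Z => γ ^ t * g (ω t)) (chainLaw p₀ K) :=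
    fun t => (integrable_of_discrete (chainLaw p₀ K) (measurable_pi_apply t) g).const_mul (γ ^ t)
  rw [← integral_tsum_of_summable_integral_norm hint]
  · simp_rw [integral_const_mul, integral_chainLaw]
    simp only [chainValue]
    simp_rw [← tsum_mul_left]
    rw [← Summable.tsum_finsetSum fun z _ => (summable_chainValue K hγ g z).mul_left _]
    refine tsum_congr fun t => ?_
    rw [Finset.mul_sum]
    exact Finset.sum_congr rfl fun z _ => by ring
  · refine Summable.of_nonneg_of_le (fun t => integral_nonneg fun ω => norm_nonneg _) (fun t => ?_)
      ((summable_geometric_of_lt_one hγ.1 hγ.2).mul_right B)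
    calc ∫ ω, ‖γ ^ t * g (ω t)‖ ∂(chainLaw p₀ K) ≤ ∫ _, γ ^ t * B ∂(chainLaw p₀ K) := by
          refine integral_mono (hint t).norm (integrable_const _) fun ω => ?_
          simp only [Real.norm_eq_abs, abs_mul, abs_of_nonneg (pow_nonneg hγ.1 t)]
          exact mul_le_mul_of_nonneg_left (hB _) (pow_nonneg hγ.1 t)
      _ = γ ^ t * B := by simp

end ChainExpectation

/-! ### Linearity, order and bounds for discounted sums, from the fixed-point equation. -/

section ChainValueOrder

variable {Z : Type*} [Fintype Z]

lemma chainValue_sub (K : Z → stdSimplex ℝ Z) {γ : ℝ} (hγ : γ ∈ Set.Ico (0 : ℝ) 1)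
    (g h : Z → ℝ) (z : Z) :
    chainValue K γ (fun z => g z - h z) z = chainValue K γ g z - chainValue K γ h z := by
  refine (eq_chainValue K hγ (v := fun z => chainValue K γ g z - chainValue K γ h z)
    (fun z => ?_) z).symm
  rw [chainOp_sub, chainValue_eq K hγ g z, chainValue_eq K hγ h z]
  ring

lemma chainValue_const (K : Z → stdSimplex ℝ Z) {γ : ℝ} (hγ : γ ∈ Set.Ico (0 : ℝ) 1)
    (c : ℝ) (z : Z) : chainValue K γ (fun _ => c) z = c / (1 - γ) := by
  refine (eq_chainValue K hγ (v := fun _ => c / (1 - γ)) (fun z => ?_) z).symm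
  have : (1 - γ) ≠ 0 := by have := hγ.2; linarith
  rw [chainOp_const]
  field_simp
  ring

lemma chainValue_sum_mul {ι : Type*} (K : Z → stdSimplex ℝ Z) {γ : ℝ}
    (hγ : γ ∈ Set.Ico (0 : ℝ) 1) (I : Finset ι) (c : ι → ℝ) (g : ι → Z → ℝ) (z : Z) :
    chainValue K γ (fun z => ∑ i ∈ I, c i * g i z) z = ∑ i ∈ I, c i * chainValue K γ (g i) z := by
  refine (eq_chainValue K hγ (v := fun z => ∑ i ∈ I, c i * chainValue K γ (g i) z)
    (fun z => ?_) z).symm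
  simp only [chainOp_sum, chainOp_mul, Finset.mul_sum, ← Finset.sum_add_distrib]
  refine Finset.sum_congr rfl fun i _ => ?_
  rw [chainValue_eq K hγ (g i) z]
  ring

lemma chainValue_nonneg (K : Z → stdSimplex ℝ Z) {γ : ℝ} (hγ : γ ∈ Set.Ico (0 : ℝ) 1)
    {g : Z → ℝ} (hg : ∀ z, 0 ≤ g z) (z : Z) : 0 ≤ chainValue K γ g z :=
  nonneg_of_chainOp_le K hγ (fun z => by rw [chainValue_eq K hγ g z]; linarith [hg z]) z

lemma chainValue_mono (K : Z → stdSimplex ℝ Z) {γ : ℝ} (hγ : γ ∈ Set.Ico (0 : ℝ) 1)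
    {g h : Z → ℝ} (H : ∀ z, g z ≤ h z) (z : Z) : chainValue K γ g z ≤ chainValue K γ h z := by
  have := chainValue_nonneg K hγ (g := fun z => h z - g z) (fun z => sub_nonneg.2 (H z)) z
  rw [chainValue_sub K hγ] at this
  linarith

/-- Keeps only the time-zero term of a nonnegative series. It gives both d_ρ ≥ (1−γ)ρ and the
statewise improvement of the value. -/
lemma le_chainValue (K : Z → stdSimplex ℝ Z) {γ : ℝ} (hγ : γ ∈ Set.Ico (0 : ℝ) 1)
    {g : Z → ℝ} (hg : ∀ z, 0 ≤ g z) (z : Z) : g z ≤ chainValue K γ g z := by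
  rw [chainValue_eq K hγ g z]
  have := chainOp_mono K (fun z => chainValue_nonneg K hγ hg z) z
  rw [chainOp_const] at this
  nlinarith [hγ.1]

lemma abs_chainValue_le (K : Z → stdSimplex ℝ Z) {γ : ℝ} (hγ : γ ∈ Set.Ico (0 : ℝ) 1)
    {g : Z → ℝ} {B : ℝ} (H : ∀ z, |g z| ≤ B) (z : Z) : |chainValue K γ g z| ≤ B / (1 - γ) := by
  rw [abs_le]
  constructor
  · rw [← neg_div, ← chainValue_const K hγ (-B) z]
    exact chainValue_mono K hγ (fun z => (abs_le.1 (H z)).1) z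
  · rw [← chainValue_const K hγ B z]
    exact chainValue_mono K hγ (fun z => (abs_le.1 (H z)).2) z

end ChainValueOrder

/-! ### Bellman equations, visitation measures and performance differences. -/

namespace FiniteMDP

variable {S A : Type*} [Fintype S] [Fintype A] (M : FiniteMDP S A)

/-- The transition probabilities on state-action pairs under the policy `π`. -/
def pairKernel (π : Policy S A) (z : S × A) : stdSimplex ℝ (S × A) :=
  stateActionLaw (M.P z.1 z.2) π

/-- The transition probabilities on states under the policy `π`. -/
def policyKernel (π : Policy S A) (s : S) : stdSimplex ℝ S :=
  ⟨fun s' => ∑ a, π s a * M.P s a s',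
    fun _ => Finset.sum_nonneg fun _ _ =>
      mul_nonneg (stdSimplex.zero_le _ _) (stdSimplex.zero_le _ _), by
    rw [Finset.sum_comm]
    simp [← Finset.mul_sum]⟩

lemma one_sub_γ_pos : 0 < 1 - M.γ := sub_pos.2 M.γ_mem.2

lemma sum_stateActionLaw {S A : Type*} [Fintype S] [Fintype A]
    (p : stdSimplex ℝ S) (π : Policy S A) (g : S × A → ℝ) :
    ∑ z, stateActionLaw p π z * g z = ∑ s, p s * ∑ a, π s a * g (s, a) := by
  rw [Fintype.sum_prod_type]
  refine Finset.sum_congr rfl fun s _ => ?_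
  rw [Finset.mul_sum]
  refine Finset.sum_congr rfl fun a _ => ?_
  change p s * π s a * g (s, a) = _
  ring

lemma sum_vertex {X : Type*} [Fintype X] [DecidableEq X] (x : X) (g : X → ℝ) :
    ∑ y, stdSimplex.vertex (S := ℝ) x y * g y = g x := by
  have : ∀ y, stdSimplex.vertex (S := ℝ) x y = if y = x then 1 else 0 := fun y => by
    change (Pi.single x (1 : ℝ) : X → ℝ) y = _
    rw [Pi.single_apply]
  simp [this]

lemma chainOp_pairKernel (π : Policy S A) (g : S × A → ℝ) (s : S) (a : A) :
    chainOp (M.pairKernel π) g (s, a) = ∑ s', M.P s a s' * ∑ a', π s' a' * g (s', a') :=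
  sum_stateActionLaw (M.P s a) π g

lemma chainOp_policyKernel (π : Policy S A) (u : S → ℝ) (s : S) :
    chainOp (M.policyKernel π) u s = ∑ a, π s a * ∑ s', M.P s a s' * u s' := by
  change ∑ s', (∑ a, π s a * M.P s a s') * u s' = _
  simp only [Finset.sum_mul, Finset.mul_sum]
  rw [Finset.sum_comm]
  exact Finset.sum_congr rfl fun _ _ => Finset.sum_congr rfl fun _ _ => by ring

lemma expect_discounted (π : Policy S A) (p₀ : stdSimplex ℝ (S × A)) (g : S × A → ℝ) :
    M.expect π p₀ (fun ω => ∑' t : ℕ, M.γ ^ t * g (ω t)) =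
      ∑ z, p₀ z * chainValue (M.pairKernel π) M.γ g z :=
  chainExp_discounted _ _ M.γ_mem g

lemma Q_eq_chainValue (π : Policy S A) (s : S) (a : A) :
    M.Q π s a = chainValue (M.pairKernel π) M.γ (fun z => M.r z.1 z.2) (s, a) := by
  classical
  refine (M.expect_discounted π _ (fun z => M.r z.1 z.2)).trans ?_
  exact sum_vertex (s, a) (chainValue (M.pairKernel π) M.γ fun z => M.r z.1 z.2)

/-- `V^π(s) = ∑ a, π(a|s) Q^π(s,a)`. -/
lemma V_eq_sum_Q (π : Policy S A) (s : S) : M.V π s = ∑ a, π s a * M.Q π s a := by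
  classical
  refine (M.expect_discounted π _ (fun z => M.r z.1 z.2)).trans ?_
  rw [sum_stateActionLaw, sum_vertex]
  simp [Q_eq_chainValue]

/-- `Q^π(s,a) = r(s,a) + γ ∑ s', P(s'|s,a) V^π(s')`. -/
lemma Q_eq (π : Policy S A) (s : S) (a : A) :
    M.Q π s a = M.r s a + M.γ * ∑ s', M.P s a s' * M.V π s' := by
  rw [Q_eq_chainValue, chainValue_eq _ M.γ_mem, chainOp_pairKernel]
  simp only [V_eq_sum_Q, Q_eq_chainValue]

/-- For functions of the state alone, averaging out the action turns the state-action chain into the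
state chain: both sides solve the same fixed-point equation. -/
lemma sum_policy_chainValue (π : Policy S A) (h : S → ℝ) (s : S) :
    ∑ a, π s a * chainValue (M.pairKernel π) M.γ (fun z => h z.1) (s, a) =
      chainValue (M.policyKernel π) M.γ h s := by
  refine eq_chainValue _ M.γ_mem (v := fun s =>
    ∑ a, π s a * chainValue (M.pairKernel π) M.γ (fun z => h z.1) (s, a)) (fun s => ?_) s
  rw [chainOp_policyKernel]
  conv_lhs =>
    enter [2, a]
    rw [chainValue_eq _ M.γ_mem, chainOp_pairKernel]
  simp only [mul_add, Finset.sum_add_distrib]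
  rw [← Finset.sum_mul, stdSimplex.sum_eq_one, one_mul, Finset.mul_sum]
  congr 1
  exact Finset.sum_congr rfl fun _ _ => by ring

/-- Integration against the visitation measure. -/
lemma sum_visitation_mul (ρ : stdSimplex ℝ S) (π : Policy S A) (h : S → ℝ) :
    ∑ s, M.visitation ρ π s * h s =
      (1 - M.γ) * ∑ s, ρ s * chainValue (M.policyKernel π) M.γ h s := by
  classical
  have hv : ∀ s, M.visitation ρ π s = (1 - M.γ) *
      ∑ s', ρ s' * chainValue (M.policyKernel π) M.γ (fun x => if x = s then 1 else 0) s' := by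
    intro s
    unfold visitation
    congr 1
    have e := M.expect_discounted π (stateActionLaw ρ π) (fun z => if z.1 = s then 1 else 0)
    rw [sum_stateActionLaw] at e
    convert e using 3
    rename_i s' _
    rw [← sum_policy_chainValue]
  -- Expand h in indicators of states, whose discounted sums define the visitation measure.
  have hh : ∀ s', chainValue (M.policyKernel π) M.γ h s' =
      ∑ s, h s * chainValue (M.policyKernel π) M.γ (fun x => if x = s then 1 else 0) s' := by
    intro s'
    rw [← chainValue_sum_mul _ M.γ_mem]
    simp
  simp only [hv, hh, Finset.mul_sum, Finset.sum_mul]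
  rw [Finset.sum_comm]
  exact Finset.sum_congr rfl fun _ _ => Finset.sum_congr rfl fun _ _ => by ring

lemma sum_visitation (ρ : stdSimplex ℝ S) (π : Policy S A) : ∑ s, M.visitation ρ π s = 1 := by
  have := M.sum_visitation_mul ρ π (fun _ => 1)
  simp only [mul_one, chainValue_const _ M.γ_mem] at this
  rw [this, ← Finset.sum_mul, stdSimplex.sum_eq_one]
  have := M.one_sub_γ_pos
  field_simp

lemma visitation_eq (ρ : stdSimplex ℝ S) (π : Policy S A) [DecidableEq S] (s : S) :
    M.visitation ρ π s = (1 - M.γ) * ∑ s', ρ s' *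
      chainValue (M.policyKernel π) M.γ (fun x => if x = s then 1 else 0) s' := by
  rw [← sum_visitation_mul]
  simp

lemma visitation_ge (ρ : stdSimplex ℝ S) (π : Policy S A) (s : S) :
    (1 - M.γ) * ρ s ≤ M.visitation ρ π s := by
  classical
  rw [visitation_eq]
  refine mul_le_mul_of_nonneg_left ?_ M.one_sub_γ_pos.le
  calc ρ s = ∑ s', ρ s' * (if s' = s then 1 else 0) := by simp
    _ ≤ _ := Finset.sum_le_sum fun s' _ => mul_le_mul_of_nonneg_left
        (le_chainValue _ M.γ_mem (g := fun x => if x = s then (1 : ℝ) else 0)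
          (fun x => by positivity) s') (stdSimplex.zero_le _ _)

lemma visitation_nonneg (ρ : stdSimplex ℝ S) (π : Policy S A) (s : S) :
    0 ≤ M.visitation ρ π s :=
  (mul_nonneg M.one_sub_γ_pos.le (stdSimplex.zero_le ρ s)).trans (M.visitation_ge ρ π s)

lemma visitation_le_one (ρ : stdSimplex ℝ S) (π : Policy S A) (s : S) :
    M.visitation ρ π s ≤ 1 := by
  rw [← M.sum_visitation ρ π]
  exact Finset.single_le_sum (fun s _ => M.visitation_nonneg ρ π s) (Finset.mem_univ s)

lemma Q_sub_Q (π π' : Policy S A) (s : S) (a : A) :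
    M.Q π' s a - M.Q π s a = M.γ * ∑ s', M.P s a s' * (M.V π' s' - M.V π s') := by
  simp only [Q_eq, mul_sub, Finset.sum_sub_distrib]
  ring

/-- Performance difference lemma, pointwise form. -/
lemma V_sub_V (π π' : Policy S A) (s : S) :
    M.V π' s - M.V π s =
      chainValue (M.policyKernel π') M.γ (fun s => ∑ a, π' s a * (M.Q π s a - M.V π s)) s := by
  refine eq_chainValue _ M.γ_mem (v := fun s => M.V π' s - M.V π s) (fun s => ?_) s
  have h1 : ∑ a, π' s a * (M.Q π s a - M.V π s) = ∑ a, π' s a * M.Q π s a - M.V π s := by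
    simp only [mul_sub, Finset.sum_sub_distrib, ← Finset.sum_mul, stdSimplex.sum_eq_one, one_mul]
  rw [h1, chainOp_policyKernel, Finset.mul_sum, V_eq_sum_Q M π' s]
  have h2 : ∀ a, M.γ * (π' s a * ∑ s', M.P s a s' * (M.V π' s' - M.V π s')) =
      π' s a * M.Q π' s a - π' s a * M.Q π s a := fun a => by
    rw [← mul_sub, Q_sub_Q]
    ring
  simp only [h2, Finset.sum_sub_distrib]
  ring

/-- Performance difference lemma with the roles of the two policies exchanged. -/
lemma V_sub_V_eq_chainValue_sub (π π' : Policy S A) (s : S) :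
    M.V π' s - M.V π s =
      chainValue (M.policyKernel π) M.γ (fun s => ∑ a, (π' s a - π s a) * M.Q π' s a) s := by
  refine eq_chainValue _ M.γ_mem (v := fun s => M.V π' s - M.V π s) (fun s => ?_) s
  rw [chainOp_policyKernel, Finset.mul_sum, V_eq_sum_Q M π' s, V_eq_sum_Q M π s]
  have h2 : ∀ a, M.γ * (π s a * ∑ s', M.P s a s' * (M.V π' s' - M.V π s')) =
      π s a * M.Q π' s a - π s a * M.Q π s a := fun a => by
    rw [← mul_sub, Q_sub_Q]
    ring
  simp only [h2, Finset.sum_sub_distrib, sub_mul]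
  ring

lemma Vavg_sub_Vavg (ρ : stdSimplex ℝ S) (π π' : Policy S A) :
    M.Vavg ρ π' - M.Vavg ρ π = 1 / (1 - M.γ) *
      ∑ s, M.visitation ρ π' s * ∑ a, π' s a * (M.Q π s a - M.V π s) := by
  have := M.one_sub_γ_pos
  rw [sum_visitation_mul]
  simp only [← V_sub_V]
  rw [← mul_assoc, one_div_mul_cancel this.ne', one_mul]
  simp only [Vavg, mul_sub, Finset.sum_sub_distrib]

lemma Vavg_sub_Vavg' (ρ : stdSimplex ℝ S) (π π' : Policy S A) :
    M.Vavg ρ π' - M.Vavg ρ π = 1 / (1 - M.γ) *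
      ∑ s, M.visitation ρ π s * ∑ a, (π' s a - π s a) * M.Q π' s a := by
  have := M.one_sub_γ_pos
  rw [sum_visitation_mul]
  simp only [← V_sub_V_eq_chainValue_sub]
  rw [← mul_assoc, one_div_mul_cancel this.ne', one_mul]
  simp only [Vavg, mul_sub, Finset.sum_sub_distrib]

lemma sum_policy_mul_advantage (π : Policy S A) (s : S) :
    ∑ a, π s a * (M.Q π s a - M.V π s) = 0 := by
  simp only [mul_sub, Finset.sum_sub_distrib, ← Finset.sum_mul, stdSimplex.sum_eq_one, one_mul]
  rw [V_eq_sum_Q, sub_self]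

lemma Q_mem_Icc (π : Policy S A) (s : S) (a : A) :
    M.Q π s a ∈ Set.Icc 0 (1 / (1 - M.γ)) := by
  rw [Q_eq_chainValue]
  refine ⟨chainValue_nonneg _ M.γ_mem (fun z : S × A => (M.r_mem z.1 z.2).1) _, ?_⟩
  rw [← chainValue_const (M.pairKernel π) M.γ_mem 1 (s, a)]
  exact chainValue_mono _ M.γ_mem (fun z : S × A => (M.r_mem z.1 z.2).2) _

lemma V_mem_Icc (π : Policy S A) (s : S) : M.V π s ∈ Set.Icc 0 (1 / (1 - M.γ)) := by
  rw [V_eq_sum_Q]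
  constructor
  · exact Finset.sum_nonneg fun a _ => mul_nonneg (stdSimplex.zero_le _ _) (M.Q_mem_Icc π s a).1
  · calc _ ≤ ∑ a, π s a * (1 / (1 - M.γ)) := Finset.sum_le_sum fun a _ =>
          mul_le_mul_of_nonneg_left (M.Q_mem_Icc π s a).2 (stdSimplex.zero_le _ _)
      _ = _ := by rw [← Finset.sum_mul, stdSimplex.sum_eq_one, one_mul]

lemma abs_advantage_le (π : Policy S A) (s : S) (a : A) :
    |M.Q π s a - M.V π s| ≤ 1 / (1 - M.γ) := by
  have h1 := M.Q_mem_Icc π s a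
  have h2 := M.V_mem_Icc π s
  rw [abs_le]
  constructor <;> linarith [h1.1, h1.2, h2.1, h2.2]

/-! ### Optimal policies -/

open Classical in
/-- The deterministic policy choosing the action `f s` in state `s`. -/
def detPolicy {S A : Type*} [Fintype A] (f : S → A) : Policy S A := fun s => stdSimplex.vertex (f s)

lemma sum_detPolicy {S A : Type*} [Fintype A] (f : S → A) (s : S) (g : A → ℝ) : ∑ a, detPolicy f s a * g a = g (f s) := by
  classical
  exact sum_vertex _ _

lemma V_le_of_Q_le_V {π : Policy S A} (h : ∀ s a, M.Q π s a ≤ M.V π s) (π' : Policy S A) (s : S) :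
    M.V π' s ≤ M.V π s := by
  have h1 := M.V_sub_V π π' s
  have h2 := chainValue_mono (M.policyKernel π') M.γ_mem
    (g := fun s => ∑ a, π' s a * (M.Q π s a - M.V π s)) (h := fun _ => 0)
    (fun s => Finset.sum_nonpos fun a _ =>
      mul_nonpos_of_nonneg_of_nonpos (stdSimplex.zero_le _ _) (sub_nonpos.2 (h s a))) s
  rw [chainValue_const _ M.γ_mem, zero_div] at h2
  linarith

/-- Policy improvement: among the finitely many deterministic policies take one of maximal total
value. If Q > V at some (s, a), switching to a at s has nonnegative advantage everywhere and
positive advantage at s, so the total would grow. Such a policy attains both suprema `Vstar` and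
`Qstar`. -/
lemma exists_Q_le_V [Nonempty A] : ∃ π : Policy S A, ∀ s a, M.Q π s a ≤ M.V π s := by
  classical
  obtain ⟨f, hf⟩ := Finite.exists_max fun f : S → A => ∑ s, M.V (detPolicy f) s
  refine ⟨detPolicy f, fun s a => ?_⟩
  by_contra! hlt
  have hadv : ∀ x, ∑ b, detPolicy (Function.update f s a) x b *
      (M.Q (detPolicy f) x b - M.V (detPolicy f) x) =
      if x = s then M.Q (detPolicy f) s a - M.V (detPolicy f) s else 0 := by
    intro x
    rw [sum_detPolicy]
    split_ifs with hx
    · subst hx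
      simp
    · rw [Function.update_of_ne hx, M.V_eq_sum_Q, sum_detPolicy, sub_self]
  have hle : ∀ x, (if x = s then M.Q (detPolicy f) s a - M.V (detPolicy f) s else 0) ≤
      M.V (detPolicy (Function.update f s a)) x - M.V (detPolicy f) x := by
    intro x
    rw [M.V_sub_V]
    simp only [hadv]
    refine le_chainValue _ M.γ_mem (g := fun x => if x = s then
      M.Q (detPolicy f) s a - M.V (detPolicy f) s else 0) (fun z => ?_) x
    split_ifs <;> linarith
  have := hf (Function.update f s a)
  have hsum := Finset.sum_le_sum fun x (_ : x ∈ Finset.univ) => hle x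
  rw [Finset.sum_sub_distrib] at hsum
  simp at hsum
  linarith

lemma bddAbove_V (s : S) : BddAbove (Set.range fun π : Policy S A => M.V π s) :=
  ⟨_, by rintro _ ⟨π, rfl⟩; exact (M.V_mem_Icc π s).2⟩

lemma bddAbove_Q (s : S) (a : A) : BddAbove (Set.range fun π : Policy S A => M.Q π s a) :=
  ⟨_, by rintro _ ⟨π, rfl⟩; exact (M.Q_mem_Icc π s a).2⟩

lemma V_le_Vstar (π : Policy S A) (s : S) : M.V π s ≤ M.Vstar s := le_ciSup (M.bddAbove_V s) π

lemma Q_le_Qstar (π : Policy S A) (s : S) (a : A) : M.Q π s a ≤ M.Qstar s a :=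
  le_ciSup (M.bddAbove_Q s a) π

lemma sum_P_mono {s : S} {a : A} {u v : S → ℝ} (h : ∀ s, u s ≤ v s) :
    ∑ s', M.P s a s' * u s' ≤ ∑ s', M.P s a s' * v s' :=
  Finset.sum_le_sum fun s' _ => mul_le_mul_of_nonneg_left (h s') (stdSimplex.zero_le _ _)

lemma Q_mono {π π' : Policy S A} (h : ∀ s, M.V π s ≤ M.V π' s) (s : S) (a : A) :
    M.Q π s a ≤ M.Q π' s a := by
  rw [Q_eq, Q_eq]
  have := mul_le_mul_of_nonneg_left (M.sum_P_mono (s := s) (a := a) h) M.γ_mem.1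
  linarith

lemma Vstar_eq_of_Q_le_V {π : Policy S A} (h : ∀ s a, M.Q π s a ≤ M.V π s) (s : S) :
    M.Vstar s = M.V π s :=
  haveI : Nonempty (Policy S A) := ⟨π⟩
  le_antisymm (ciSup_le fun π' => M.V_le_of_Q_le_V h π' s) (M.V_le_Vstar π s)

lemma Qstar_eq_of_Q_le_V {π : Policy S A} (h : ∀ s a, M.Q π s a ≤ M.V π s) (s : S) (a : A) :
    M.Qstar s a = M.Q π s a :=
  haveI : Nonempty (Policy S A) := ⟨π⟩
  le_antisymm (ciSup_le fun π' => M.Q_mono (fun s => M.V_le_of_Q_le_V h π' s) s a)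
    (M.Q_le_Qstar π s a)

lemma sum_policy_mul_Astar (π : Policy S A) (s : S) :
    ∑ a, π s a * M.Astar s a = ∑ a, π s a * M.Qstar s a - M.Vstar s := by
  simp only [Astar, mul_sub, Finset.sum_sub_distrib, ← Finset.sum_mul, stdSimplex.sum_eq_one,
    one_mul]

variable [Nonempty A]

lemma Qstar_eq (s : S) (a : A) :
    M.Qstar s a = M.r s a + M.γ * ∑ s', M.P s a s' * M.Vstar s' := by
  obtain ⟨π, hπ⟩ := M.exists_Q_le_V
  simp only [M.Qstar_eq_of_Q_le_V hπ, M.Vstar_eq_of_Q_le_V hπ, Q_eq]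

lemma Astar_nonpos (s : S) (a : A) : M.Astar s a ≤ 0 := by
  obtain ⟨π, hπ⟩ := M.exists_Q_le_V
  rw [Astar, M.Qstar_eq_of_Q_le_V hπ, M.Vstar_eq_of_Q_le_V hπ]
  linarith [hπ s a]

/-- Otherwise every advantage of an optimal policy at s would be negative, although they average to
zero under that policy. -/
lemma exists_Astar_eq_zero (s : S) : ∃ a, M.Astar s a = 0 := by
  obtain ⟨π, hπ⟩ := M.exists_Q_le_V
  by_contra! hne
  have hlt : ∀ a, M.Q π s a - M.V π s < 0 := fun a => by
    have := lt_of_le_of_ne (M.Astar_nonpos s a) (hne a)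
    rwa [Astar, M.Qstar_eq_of_Q_le_V hπ, M.Vstar_eq_of_Q_le_V hπ] at this
  obtain ⟨a, -, ha⟩ : ∃ a ∈ Finset.univ, π s a ≠ 0 :=
    Finset.exists_ne_zero_of_sum_ne_zero (by rw [stdSimplex.sum_eq_one]; exact one_ne_zero)
  have hpos : 0 < π s a := lt_of_le_of_ne (stdSimplex.zero_le _ _) ha.symm
  have h0 := M.sum_policy_mul_advantage π s
  have : ∑ a, π s a * (M.Q π s a - M.V π s) < 0 :=
    Finset.sum_neg' (fun a _ => mul_nonpos_of_nonneg_of_nonpos (stdSimplex.zero_le _ _) (hlt a).le)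
      ⟨a, Finset.mem_univ _, mul_neg_of_pos_of_neg hpos (hlt a)⟩
  linarith

lemma mem_optActions {s : S} {a : A} : a ∈ M.optActions s ↔ M.Astar s a = 0 := by
  classical
  simp only [optActions, Finset.mem_filter, Finset.mem_univ, true_and]
  constructor
  · intro h
    obtain ⟨b, hb⟩ := M.exists_Astar_eq_zero s
    exact le_antisymm (M.Astar_nonpos s a) (hb ▸ h b)
  · intro h b
    rw [h]
    exact M.Astar_nonpos s b

lemma optActions_nonempty (s : S) : (M.optActions s).Nonempty := by
  obtain ⟨a, ha⟩ := M.exists_Astar_eq_zero s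
  exact ⟨a, M.mem_optActions.2 ha⟩

/-- Complementary slackness: an optimal policy averages the nonpositive `Astar` to zero, so each
term vanishes. Conversely, vanishing terms make the performance difference from an optimal policy
zero. -/
lemma isOptimal_iff {π : Policy S A} :
    M.IsOptimal π ↔ ∀ s, ∀ a ∉ M.optActions s, π s a = 0 := by
  constructor
  · intro h s a ha
    have hQ : ∀ a, M.Qstar s a = M.Q π s a := fun a => by
      rw [Qstar_eq, Q_eq]
      simp only [h _]
    have h0 : ∑ a, π s a * M.Astar s a = 0 := by
      rw [sum_policy_mul_Astar, ← h s, V_eq_sum_Q]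
      simp only [hQ, sub_self]
    have := (Finset.sum_eq_zero_iff_of_nonpos fun a _ =>
      mul_nonpos_of_nonneg_of_nonpos (stdSimplex.zero_le (π s) a) (M.Astar_nonpos s a)).1 h0 a
      (Finset.mem_univ a)
    rcases mul_eq_zero.1 this with h | h
    · exact h
    · exact absurd (M.mem_optActions.2 h) ha
  · intro h s
    obtain ⟨πs, hπs⟩ := M.exists_Q_le_V
    have h1 := M.V_sub_V πs π s
    have h2 : ∀ s, ∑ a, π s a * (M.Q πs s a - M.V πs s) = 0 := fun s =>
      Finset.sum_eq_zero fun a _ => by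
        rw [← M.Qstar_eq_of_Q_le_V hπs, ← M.Vstar_eq_of_Q_le_V hπs]
        by_cases ha : a ∈ M.optActions s
        · rw [← Astar, M.mem_optActions.1 ha, mul_zero]
        · rw [h s a ha, zero_mul]
    simp only [h2, chainValue_const _ M.γ_mem, zero_div] at h1
    rw [M.Vstar_eq_of_Q_le_V hπs]
    linarith

lemma detPolicy_isOptimal {f : S → A} (hf : ∀ s, f s ∈ M.optActions s) :
    M.IsOptimal (detPolicy f) := by
  classical
  refine M.isOptimal_iff.2 fun s a ha => ?_
  have hne : a ≠ f s := fun h => ha (h ▸ hf s)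
  change (Pi.single (f s) (1 : ℝ) : A → ℝ) a = 0
  exact Pi.single_eq_of_ne hne _

/-- The optimal policy is unique exactly when every state has one optimal action. -/
lemma existsUnique_isOptimal_iff :
    (∃! π : Policy S A, M.IsOptimal π) ↔ ∀ s, (M.optActions s).card = 1 := by
  classical
  choose f hf using M.optActions_nonempty
  constructor
  · intro h s
    rw [Finset.card_eq_one]
    refine ⟨f s, Finset.eq_singleton_iff_unique_mem.2 ⟨hf s, fun a ha => ?_⟩⟩
    -- A second optimal action at s, used there only, would give a second optimal deterministic
    -- policy.
    have heq := h.unique (M.detPolicy_isOptimal hf)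
      (M.detPolicy_isOptimal (f := Function.update f s a) fun x => by
        by_cases hx : x = s
        · subst hx
          simpa using ha
        · simpa [Function.update_of_ne hx] using hf x)
    have := stdSimplex.vertex_injective (S := ℝ) (congrFun heq s)
    simpa using this.symm
  · intro h
    refine ⟨detPolicy f, M.detPolicy_isOptimal hf, fun π hπ => ?_⟩
    have huniq : ∀ s a, a ≠ f s → a ∉ M.optActions s := fun s a hne ha =>
      hne (Finset.card_le_one.1 (h s).le a ha (f s) (hf s))
    have hoff : ∀ s a, a ≠ f s → π s a = 0 := fun s a hne =>
      M.isOptimal_iff.1 hπ s a (huniq s a hne)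
    funext s
    refine DFunLike.ext _ _ fun a => ?_
    change _ = (Pi.single (f s) (1 : ℝ) : A → ℝ) a
    by_cases ha : a = f s
    · subst ha
      rw [Pi.single_eq_same, ← stdSimplex.sum_eq_one (π s)]
      exact (Finset.sum_eq_single _ (fun b _ hb => hoff s b hb) (by simp)).symm
    · rw [Pi.single_eq_of_ne ha, hoff s a ha]

end FiniteMDP

/-- If `u` is differentiable at `x` and `v` is continuous at `x`, then
`y ↦ (u y - u x) * v y` is differentiable at `x`. -/
lemma HasFDerivAt.sub_const_mul_of_continuousAt {E : Type*} [NormedAddCommGroup E]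
    [NormedSpace ℝ E] {u v : E → ℝ} {u' : E →L[ℝ] ℝ} {x : E} (hu : HasFDerivAt u u' x)
    (hv : ContinuousAt v x) : HasFDerivAt (fun y => (u y - u x) * v y) (v x • u') x := by
  have h1 : (fun y => (u y - u x) * (v y - v x)) =o[nhds x] fun y => y - x := by
    have ho : (fun y => v y - v x) =o[nhds x] fun _ => (1 : ℝ) := by
      rw [Asymptotics.isLittleO_one_iff]
      have := hv.tendsto.sub_const (v x)
      rwa [sub_self] at this
    have := hu.isBigO_sub.norm_right.mul_isLittleO ho
    simp only [mul_one] at this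
    exact this.of_norm_right
  have h2 : HasFDerivAt (fun y => (u y - u x) * (v y - v x)) (0 : E →L[ℝ] ℝ) x := by
    refine .of_isLittleO ?_
    simpa using h1
  have h3 : HasFDerivAt (fun y => v x * (u y - u x)) (v x • u') x :=
    (hu.sub_const (u x)).const_mul (v x)
  have := h2.add h3
  rw [zero_add] at this
  refine this.congr_of_eventuallyEq (Filter.Eventually.of_forall fun y => ?_)
  simp only [Pi.add_apply]
  ring

/-! ### Derivative of the softmax value and the policy gradient theorem. -/

section SoftmaxGradient

variable {S A : Type*} [Fintype A] [Nonempty A]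

lemma softmaxPolicy_apply (θ : EuclideanSpace ℝ (S × A)) (s : S) (a : A) :
    softmaxPolicy θ s a = Real.exp (θ (s, a)) / ∑ b, Real.exp (θ (s, b)) := rfl

lemma sum_exp_pos (θ : EuclideanSpace ℝ (S × A)) (s : S) : 0 < ∑ b, Real.exp (θ (s, b)) := by
  positivity

lemma softmaxPolicy_pos (θ : EuclideanSpace ℝ (S × A)) (s : S) (a : A) :
    0 < softmaxPolicy θ s a := by
  rw [softmaxPolicy_apply]
  positivity

/-- The derivative of `θ ↦ π_θ(a|s)`. -/
def softmaxDeriv (θ : EuclideanSpace ℝ (S × A)) (s : S) (a : A) :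
    EuclideanSpace ℝ (S × A) →L[ℝ] ℝ :=
  softmaxPolicy θ s a • (EuclideanSpace.proj (s, a) -
    ∑ b, softmaxPolicy θ s b • EuclideanSpace.proj (𝕜 := ℝ) (s, b))

lemma softmaxDeriv_single [DecidableEq S] [DecidableEq A] (θ : EuclideanSpace ℝ (S × A))
    (s s' : S) (a a' : A) :
    softmaxDeriv θ s a (EuclideanSpace.single (s', a') 1) =
      if s = s' then softmaxPolicy θ s a * ((if a = a' then 1 else 0) - softmaxPolicy θ s a')
      else 0 := by
  by_cases hs : s = s'
  · simp [softmaxDeriv, hs]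
  · simp [softmaxDeriv, hs]

variable [Fintype S]

lemma hasFDerivAt_softmaxPolicy (θ : EuclideanSpace ℝ (S × A)) (s : S) (a : A) :
    HasFDerivAt (fun θ => softmaxPolicy θ s a) (softmaxDeriv θ s a) θ := by
  have hexp : ∀ b, HasFDerivAt (fun θ : EuclideanSpace ℝ (S × A) => Real.exp (θ (s, b)))
      (Real.exp (θ (s, b)) • EuclideanSpace.proj (𝕜 := ℝ) (s, b)) θ := fun b =>
    (EuclideanSpace.proj (𝕜 := ℝ) (s, b)).hasFDerivAt.exp
  have hZ := HasFDerivAt.fun_sum fun b (_ : b ∈ Finset.univ) => hexp b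
  have hne := (sum_exp_pos θ s).ne'
  have := (hexp a).mul ((hasDerivAt_inv hne).comp_hasFDerivAt θ hZ)
  refine (this.congr_of_eventuallyEq (Filter.Eventually.of_forall fun θ' => ?_)).congr_fderiv ?_
  · exact div_eq_mul_inv _ _
  ext v
  simp only [softmaxDeriv, softmaxPolicy_apply, smul_apply,
    sub_apply, sum_apply, smul_eq_mul,
    add_apply, Function.comp_apply, div_mul_eq_mul_div, ← Finset.sum_div]
  field_simp
  ring

namespace FiniteMDP

variable (M : FiniteMDP S A)

/-- The performance difference lemma with 0 ≤ Q ≤ 1/(1−γ) makes the value Lipschitz in the policy.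
-/
lemma continuousAt_V_softmaxPolicy (θ : EuclideanSpace ℝ (S × A)) (s : S) :
    ContinuousAt (fun θ' => M.V (softmaxPolicy θ') s) θ := by
  have hb : ∀ θ', |M.V (softmaxPolicy θ') s - M.V (softmaxPolicy θ) s| ≤
      (∑ s, ∑ a, |softmaxPolicy θ' s a - softmaxPolicy θ s a| * (1 / (1 - M.γ))) / (1 - M.γ) := by
    intro θ'
    rw [V_sub_V_eq_chainValue_sub]
    refine abs_chainValue_le _ M.γ_mem (fun s => ?_) s
    refine le_trans ?_ (Finset.single_le_sum (f := fun s => ∑ a,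
      |softmaxPolicy θ' s a - softmaxPolicy θ s a| * (1 / (1 - M.γ))) (fun s _ =>
        Finset.sum_nonneg fun a _ => mul_nonneg (abs_nonneg _)
          (one_div_nonneg.2 M.one_sub_γ_pos.le)) (Finset.mem_univ s))
    refine (Finset.abs_sum_le_sum_abs _ _).trans (Finset.sum_le_sum fun a _ => ?_)
    rw [abs_mul]
    refine mul_le_mul_of_nonneg_left ?_ (abs_nonneg _)
    have := M.Q_mem_Icc (softmaxPolicy θ') s a
    rw [abs_of_nonneg this.1]
    exact this.2
  have hc : ∀ s a, ContinuousAt (fun θ' => softmaxPolicy θ' s a) θ := fun s a =>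
    (hasFDerivAt_softmaxPolicy θ s a).continuousAt
  rw [ContinuousAt, tendsto_iff_norm_sub_tendsto_zero]
  refine squeeze_zero (fun _ => norm_nonneg _) hb ?_
  have : ContinuousAt (fun θ' => (∑ s, ∑ a, |softmaxPolicy θ' s a - softmaxPolicy θ s a| *
      (1 / (1 - M.γ))) / (1 - M.γ)) θ := by
    refine ContinuousAt.div_const (tendsto_finsetSum _ fun s _ => tendsto_finsetSum _ fun a _ =>
      ContinuousAt.mul ?_ continuousAt_const) _
    exact ((hc s a).sub continuousAt_const).abs
  simpa [ContinuousAt] using this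

lemma continuousAt_Q_softmaxPolicy (θ : EuclideanSpace ℝ (S × A)) (s : S) (a : A) :
    ContinuousAt (fun θ' => M.Q (softmaxPolicy θ') s a) θ := by
  simp only [Q_eq]
  exact continuousAt_const.add (continuousAt_const.mul (tendsto_finsetSum _ fun s' _ =>
    continuousAt_const.mul (M.continuousAt_V_softmaxPolicy θ s')))

/-- `Vavg_sub_Vavg'` writes the increment exactly with the visitation measure frozen at θ. The only
varying factors are the policy difference, which is differentiable, and Q at the new policy, for
which continuity suffices because the difference vanishes at θ. -/
lemma hasFDerivAt_Vavg_softmaxPolicy (μ : stdSimplex ℝ S) (θ : EuclideanSpace ℝ (S × A)) :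
    HasFDerivAt (fun θ => M.Vavg μ (softmaxPolicy θ))
      ((1 / (1 - M.γ)) • ∑ s, M.visitation μ (softmaxPolicy θ) s •
        ∑ a, M.Q (softmaxPolicy θ) s a • softmaxDeriv θ s a) θ := by
  have h := (HasFDerivAt.fun_sum fun s (_ : s ∈ Finset.univ) =>
    (HasFDerivAt.fun_sum fun a (_ : a ∈ Finset.univ) =>
      (hasFDerivAt_softmaxPolicy θ s a).sub_const_mul_of_continuousAt
        (M.continuousAt_Q_softmaxPolicy θ s a)).const_mul
          (M.visitation μ (softmaxPolicy θ) s)).const_mul (1 / (1 - M.γ))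
  refine (h.add_const (M.Vavg μ (softmaxPolicy θ))).congr_of_eventuallyEq
    (Filter.Eventually.of_forall fun θ' => ?_)
  simp only [← Vavg_sub_Vavg', sub_add_cancel]

/-- The policy gradient theorem for softmax policies. -/
lemma gradient_Vavg_softmaxPolicy (μ : stdSimplex ℝ S) (θ : EuclideanSpace ℝ (S × A))
    (s : S) (a : A) :
    gradient (fun θ => M.Vavg μ (softmaxPolicy θ)) θ (s, a) =
      1 / (1 - M.γ) * M.visitation μ (softmaxPolicy θ) s * (softmaxPolicy θ s a *
        (M.Q (softmaxPolicy θ) s a - M.V (softmaxPolicy θ) s)) := by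
  classical
  have h1 : gradient (fun θ => M.Vavg μ (softmaxPolicy θ)) θ (s, a) =
      fderiv ℝ (fun θ => M.Vavg μ (softmaxPolicy θ)) θ (EuclideanSpace.single (s, a) 1) := by
    rw [← InnerProductSpace.toDual_symm_apply, ← gradient, EuclideanSpace.inner_single_right]
    simp
  rw [h1, (M.hasFDerivAt_Vavg_softmaxPolicy μ θ).fderiv]
  simp only [smul_apply, sum_apply, smul_eq_mul,
    softmaxDeriv_single, mul_ite, mul_zero]
  have h2 : ∀ s', (∑ b, if s' = s then M.Q (softmaxPolicy θ) s' b *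
      (softmaxPolicy θ s' b * ((if b = a then 1 else 0) - softmaxPolicy θ s' a)) else 0) =
      if s' = s then softmaxPolicy θ s a *
        (M.Q (softmaxPolicy θ) s a - M.V (softmaxPolicy θ) s) else 0 := by
    intro s'
    split_ifs with hs
    · subst hs
      have : ∀ b, M.Q (softmaxPolicy θ) s' b *
          (softmaxPolicy θ s' b * ((if b = a then 1 else 0) - softmaxPolicy θ s' a)) =
          (if b = a then M.Q (softmaxPolicy θ) s' b * softmaxPolicy θ s' b else 0) -
            softmaxPolicy θ s' a * (softmaxPolicy θ s' b * M.Q (softmaxPolicy θ) s' b) := by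
        intro b
        split_ifs <;> ring
      simp only [this, Finset.sum_sub_distrib, ← Finset.mul_sum, ← V_eq_sum_Q]
      simp
      ring
    · simp
  simp only [h2]
  simp
  ring

lemma softmaxPG_succ (μ : stdSimplex ℝ S) (η : ℝ) (θ₀ : EuclideanSpace ℝ (S × A)) (k : ℕ)
    (s : S) (a : A) :
    M.softmaxPG μ η θ₀ (k + 1) (s, a) = M.softmaxPG μ η θ₀ k (s, a) +
      η / (1 - M.γ) * M.visitation μ (softmaxPolicy (M.softmaxPG μ η θ₀ k)) s *
        (softmaxPolicy (M.softmaxPG μ η θ₀ k) s a *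
          (M.Q (softmaxPolicy (M.softmaxPG μ η θ₀ k)) s a -
            M.V (softmaxPolicy (M.softmaxPG μ η θ₀ k)) s)) := by
  rw [softmaxPG, PiLp.add_apply, PiLp.smul_apply, gradient_Vavg_softmaxPolicy, smul_eq_mul]
  ring

end FiniteMDP

end SoftmaxGradient

/-! ### Recursive inequalities for real sequences. -/

section Sequences

/-- The recursion `δ_{k+1} ≤ δ_k - c δ_k²` forces `δ_k ≤ 1 / (c k)`. -/
lemma mul_le_one_of_le_sub_mul_sq {δ : ℕ → ℝ} {c : ℝ} (hc : 0 ≤ c) (hδ : ∀ k, 0 ≤ δ k)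
    (h : ∀ k, δ (k + 1) ≤ δ k - c * δ k ^ 2) (k : ℕ) : c * δ k * k ≤ 1 := by
  induction k with
  | zero => simp
  | succ k ih =>
    have hk : (0 : ℝ) ≤ k := k.cast_nonneg
    have h1 : c * δ (k + 1) ≤ c * δ k - (c * δ k) ^ 2 := by
      have := mul_le_mul_of_nonneg_left (h k) hc
      nlinarith
    have hx : 0 ≤ c * δ k := mul_nonneg hc (hδ k)
    push_cast
    set x := c * δ k
    -- If x ≤ 1, then (x − x²)(k+1) = (1−x)(xk + x) ≤ (1−x)(1+x) ≤ 1 by induction; if x > 1, the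
    -- next term is nonpositive.
    by_cases hx1 : x ≤ 1
    · have h2 : c * δ (k + 1) * (k + 1) ≤ (x - x ^ 2) * (k + 1) :=
        mul_le_mul_of_nonneg_right h1 (by linarith)
      have h3 : x * k * (1 - x) ≤ 1 * (1 - x) :=
        mul_le_mul_of_nonneg_right ih (by linarith)
      nlinarith [sq_nonneg x]
    · have h2 : c * δ (k + 1) ≤ 0 := by nlinarith
      have := mul_nonpos_of_nonpos_of_nonneg h2 (by linarith : (0 : ℝ) ≤ k + 1)
      linarith

lemma tendsto_atTop_of_add_mul_le {u w : ℕ → ℝ} {c : ℝ} (hc : 0 < c) (hw : ∀ k, 0 ≤ w k)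
    (hns : ¬ Summable w) (K : ℕ) (h : ∀ k ≥ K, u k + c * w k ≤ u (k + 1)) :
    Tendsto u atTop atTop := by
  have hns' : ¬ Summable fun n => w (n + K) := fun hs => hns ((summable_nat_add_iff K).1 hs)
  have ht := (not_summable_iff_tendsto_nat_atTop_of_nonneg fun n => hw (n + K)).1 hns'
  have hb : ∀ n, u K + c * ∑ i ∈ Finset.range n, w (i + K) ≤ u (n + K) := by
    intro n
    induction n with
    | zero => simp
    | succ n ih =>
      rw [Finset.sum_range_succ, mul_add, ← add_assoc]
      have := h (n + K) (Nat.le_add_left _ _)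
      rw [show n + 1 + K = n + K + 1 by omega]
      linarith
  refine (tendsto_add_atTop_iff_nat K).1 (tendsto_atTop_mono hb ?_)
  exact tendsto_atTop_add_const_left _ _ (ht.const_mul_atTop hc)

lemma le_of_eventually_antitone {u : ℕ → ℝ} {K : ℕ} (h : ∀ k ≥ K, u (k + 1) ≤ u k) :
    ∀ k ≥ K, u k ≤ u K := by
  intro k hk
  induction k, hk using Nat.le_induction with
  | base => exact le_rfl
  | succ k hk ih => exact (h k hk).trans ih

end Sequences

/-! ### Softmax gradient dynamics at a single state. -/

section SoftmaxDynamics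

variable {A : Type*} [Fintype A]

/-- If the coordinates have constant sum and decrease by at most a multiple of their softmax
weights, then the reciprocals of the partition functions are not summable. -/
lemma not_summable_inv_sum_exp [Nonempty A] {θ : ℕ → A → ℝ} {D : ℝ} (hD : 0 ≤ D)
    (hstep : ∀ k a, θ k a - D * (Real.exp (θ k a) / ∑ b, Real.exp (θ k b)) ≤ θ (k + 1) a)
    (hsum : ∀ k, ∑ a, θ (k + 1) a = ∑ a, θ k a) :
    ¬ Summable fun k => (∑ b, Real.exp (θ k b))⁻¹ := by
  intro hs
  have hZ : ∀ k, 0 < ∑ b, Real.exp (θ k b) := fun k => by positivity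
  -- The decrease of θ is at most D times the softmax weight, and exp(−θ) times that weight is
  -- exactly 1/Z; so exp(−θ) grows by at most a constant times 1/Z.
  have hone : ∀ k a, Real.exp (-θ (k + 1) a) ≤
      Real.exp (-θ k a) + D * Real.exp D * (∑ b, Real.exp (θ k b))⁻¹ := by
    intro k a
    set Z := ∑ b, Real.exp (θ k b)
    set y := D * (Real.exp (θ k a) / Z)
    have hle1 : Real.exp (θ k a) / Z ≤ 1 := by
      rw [div_le_one (hZ k)]
      exact Finset.single_le_sum (f := fun b => Real.exp (θ k b))
        (fun b _ => (Real.exp_pos _).le) (Finset.mem_univ a)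
    have hy0 : 0 ≤ y := mul_nonneg hD (div_nonneg (Real.exp_pos _).le (hZ k).le)
    have hyD : y ≤ D := mul_le_of_le_one_right hD hle1
    have he : Real.exp y ≤ 1 + y * Real.exp D := by
      have h1 := Real.add_one_le_exp (-y)
      have h2 : Real.exp (-y) * Real.exp y = 1 := by rw [← Real.exp_add]; simp
      have h3 := Real.exp_le_exp.2 hyD
      have h4 := mul_le_mul_of_nonneg_right h1 (Real.exp_pos y).le
      nlinarith
    calc Real.exp (-θ (k + 1) a) ≤ Real.exp (-θ k a + y) :=
          Real.exp_le_exp.2 (by linarith [hstep k a])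
      _ = Real.exp (-θ k a) * Real.exp y := Real.exp_add _ _
      _ ≤ Real.exp (-θ k a) * (1 + y * Real.exp D) :=
          mul_le_mul_of_nonneg_left he (Real.exp_pos _).le
      _ = Real.exp (-θ k a) + D * Real.exp D * Z⁻¹ * (Real.exp (-θ k a) * Real.exp (θ k a)) := by
          simp only [y, div_eq_mul_inv]
          ring
      _ = _ := by rw [← Real.exp_add, neg_add_cancel, Real.exp_zero, mul_one]
  -- Summability of 1/Z would bound every exp(−θ), hence every θ from below. The constant sum then
  -- bounds θ from above, so 1/Z stays away from 0, a contradiction.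
  have hbound : ∀ a, ∃ m, ∀ k, m ≤ θ k a := by
    intro a
    set W := ∑' k, (∑ b, Real.exp (θ k b))⁻¹
    have hup : ∀ k, Real.exp (-θ k a) ≤ Real.exp (-θ 0 a) + D * Real.exp D *
        ∑ i ∈ Finset.range k, (∑ b, Real.exp (θ i b))⁻¹ := by
      intro k
      induction k with
      | zero => simp
      | succ k ih =>
        rw [Finset.sum_range_succ, mul_add]
        linarith [hone k a]
    refine ⟨-Real.log (Real.exp (-θ 0 a) + D * Real.exp D * W), fun k => ?_⟩
    have hW : ∑ i ∈ Finset.range k, (∑ b, Real.exp (θ i b))⁻¹ ≤ W :=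
      hs.sum_le_tsum _ fun i _ => (inv_pos.2 (hZ i)).le
    have h1 : Real.exp (-θ k a) ≤ Real.exp (-θ 0 a) + D * Real.exp D * W :=
      (hup k).trans (by gcongr)
    have h2 := Real.log_le_log (Real.exp_pos _) h1
    rw [Real.log_exp] at h2
    linarith
  choose m hm using hbound
  have hconst : ∀ k, ∑ a, θ k a = ∑ a, θ 0 a := fun k => by
    induction k with
    | zero => rfl
    | succ k ih => rw [hsum, ih]
  have hupper : ∀ k a, θ k a ≤ m a + (∑ b, θ 0 b - ∑ b, m b) := by
    intro k a
    have := Finset.single_le_sum (f := fun b => θ k b - m b)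
      (fun b _ => sub_nonneg.2 (hm b k)) (Finset.mem_univ a)
    rw [Finset.sum_sub_distrib, hconst k] at this
    linarith
  set Zmax := ∑ a, Real.exp (m a + (∑ b, θ 0 b - ∑ b, m b))
  have hZmax : 0 < Zmax := by positivity
  have hlow : ∀ k, Zmax⁻¹ ≤ (∑ b, Real.exp (θ k b))⁻¹ := fun k =>
    inv_anti₀ (hZ k) (Finset.sum_le_sum fun a _ => Real.exp_le_exp.2 (hupper k a))
  have := ge_of_tendsto' hs.tendsto_atTop_zero hlow
  linarith [inv_pos.2 hZmax]

/-- Softmax gradient dynamics at one state: if the advantages converge, no action has a positive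
limiting advantage. -/
theorem softmax_dynamics_limit_nonpos [Nonempty A] {θ adv : ℕ → A → ℝ} {η : ℕ → ℝ} {c C B : ℝ}
    {L : A → ℝ} (hc : 0 < c) (hη : ∀ k, η k ∈ Set.Icc c C) (hB : ∀ k a, |adv k a| ≤ B)
    (hstep : ∀ k a, θ (k + 1) a =
      θ k a + η k * (Real.exp (θ k a) / (∑ b, Real.exp (θ k b)) * adv k a))
    (hzero : ∀ k, ∑ a, Real.exp (θ k a) / (∑ b, Real.exp (θ k b)) * adv k a = 0)
    (hlim : ∀ a, Tendsto (fun k => adv k a) atTop (𝓝 (L a))) (a₀ : A) : L a₀ ≤ 0 := by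
  classical
  by_contra! hpos
  have hZ : ∀ k, 0 < ∑ b, Real.exp (θ k b) := fun k => by positivity
  have hp : ∀ k a, 0 ≤ Real.exp (θ k a) / ∑ b, Real.exp (θ k b) := fun k a =>
    div_nonneg (Real.exp_pos _).le (hZ k).le
  have hη0 : ∀ k, 0 < η k := fun k => hc.trans_le (hη k).1
  have hB0 : 0 ≤ B := (abs_nonneg _).trans (hB 0 a₀)
  have hC0 : 0 ≤ C := hc.le.trans ((hη 0).1.trans (hη 0).2)
  have hns : ¬ Summable fun k => (∑ b, Real.exp (θ k b))⁻¹ := by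
    refine not_summable_inv_sum_exp (D := C * B) (by positivity) (fun k a => ?_) fun k => ?_
    · rw [hstep k a]
      have h1 : η k * |adv k a| ≤ C * B :=
        mul_le_mul (hη k).2 (hB k a) (abs_nonneg _) hC0
      have h2 := mul_le_mul_of_nonneg_right h1 (hp k a)
      have h3 := mul_le_mul_of_nonneg_right
        (mul_le_mul_of_nonneg_left (neg_abs_le (adv k a)) (hη0 k).le) (hp k a)
      nlinarith
    · simp only [hstep k, Finset.sum_add_distrib, ← Finset.mul_sum, hzero k, mul_zero, add_zero]
  have hadv₀ : ∀ᶠ k in atTop, L a₀ / 2 < adv k a₀ :=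
    (hlim a₀).eventually_const_lt (half_lt_self hpos)
  -- the parameter of `a₀` diverges
  have htop : Tendsto (fun k => θ k a₀) atTop atTop := by
    obtain ⟨K, hK⟩ := eventually_atTop.1 hadv₀
    have hmono : ∀ k ≥ K, θ K a₀ ≤ θ k a₀ := by
      intro k hk
      induction k, hk using Nat.le_induction with
      | base => exact le_rfl
      | succ k hk ih =>
        rw [hstep k a₀]
        have : 0 ≤ η k * (Real.exp (θ k a₀) / (∑ b, Real.exp (θ k b)) * adv k a₀) :=
          mul_nonneg (hη0 k).le (mul_nonneg (hp k a₀) (by linarith [hK k hk]))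
        linarith
    refine tendsto_atTop_of_add_mul_le (c := c * (L a₀ / 2) * Real.exp (θ K a₀)) (by positivity)
      (fun k => (inv_pos.2 (hZ k)).le) hns K fun k hk => ?_
    rw [hstep k a₀]
    have h1 : Real.exp (θ K a₀) ≤ Real.exp (θ k a₀) := Real.exp_le_exp.2 (hmono k hk)
    have h2 := (hη k).1
    have h3 := (hK k hk).le
    have h4 := (inv_pos.2 (hZ k)).le
    have h5 : c * (L a₀ / 2) * Real.exp (θ K a₀) ≤ η k * adv k a₀ * Real.exp (θ k a₀) := by
      have h0 := hη0 k
      have h0' : 0 ≤ adv k a₀ := by linarith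
      gcongr
    have h6 := mul_le_mul_of_nonneg_right h5 h4
    have h7 : η k * (Real.exp (θ k a₀) / (∑ b, Real.exp (θ k b)) * adv k a₀) =
        η k * adv k a₀ * Real.exp (θ k a₀) * (∑ b, Real.exp (θ k b))⁻¹ := by ring
    rw [h7]
    linarith
  -- an action of smaller limiting advantage which falls below `a₀` stays below
  have hdich : ∀ a, L a < L a₀ →
      (∀ᶠ k in atTop, θ k a ≤ θ k a₀) ∨ ∀ᶠ k in atTop, θ k a₀ < θ k a := by
    intro a ha
    obtain ⟨K, hK⟩ := eventually_atTop.1 (hadv₀.and ((hlim a).eventually_lt (hlim a₀) ha))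
    by_cases h : ∃ k ≥ K, θ k a ≤ θ k a₀
    · obtain ⟨k₁, hk₁, hle⟩ := h
      left
      filter_upwards [eventually_ge_atTop k₁] with k hk
      induction k, hk using Nat.le_induction with
      | base => exact hle
      | succ k hk ih =>
        rw [hstep k a, hstep k a₀]
        obtain ⟨h1, h2⟩ := hK k (hk₁.trans hk)
        have h3 : Real.exp (θ k a) / (∑ b, Real.exp (θ k b)) * adv k a ≤
            Real.exp (θ k a₀) / (∑ b, Real.exp (θ k b)) * adv k a₀ := by
          refine (mul_le_mul_of_nonneg_left h2.le (hp k a)).trans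
            (mul_le_mul_of_nonneg_right ?_ (by linarith))
          exact div_le_div_of_nonneg_right (Real.exp_le_exp.2 ih) (hZ k).le
        have := mul_le_mul_of_nonneg_left h3 (hη0 k).le
        linarith
    · push Not at h
      exact Or.inr (eventually_atTop.2 ⟨K, h⟩)
  -- Weights relative to a₀: the weighted advantages still sum to zero, and a₀ itself contributes
  -- more than L a₀ / 2 eventually.
  set R : ℕ → A → ℝ := fun k a => Real.exp (θ k a - θ k a₀)
  have hR : ∀ k a, Real.exp (θ k a) = R k a * Real.exp (θ k a₀) := fun k a => by
    simp only [R, ← Real.exp_add, sub_add_cancel]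
  -- The only actions that can compensate the contribution of a₀: limiting advantage zero and
  -- relative weight above 1.
  set I := Finset.univ.filter fun a => L a = 0 ∧ ∀ᶠ k in atTop, θ k a₀ < θ k a
  have hRsum : ∀ k, ∑ a, R k a * adv k a = 0 := by
    intro k
    have h1 := hzero k
    have h2 : ∀ a, Real.exp (θ k a) / (∑ b, Real.exp (θ k b)) * adv k a =
        (Real.exp (θ k a₀) / ∑ b, Real.exp (θ k b)) * (R k a * adv k a) := fun a => by
      rw [hR k a]
      ring
    simp only [h2, ← Finset.mul_sum] at h1
    have h3 : Real.exp (θ k a₀) / ∑ b, Real.exp (θ k b) ≠ 0 :=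
      (div_pos (Real.exp_pos _) (hZ k)).ne'
    exact (mul_eq_zero.1 h1).resolve_left h3
  -- Chosen so that all losses outside I total at most L a₀ / 4, less than what a₀ contributes.
  set ε := L a₀ / (4 * Fintype.card A)
  have hn : (0 : ℝ) < Fintype.card A := by exact_mod_cast Fintype.card_pos
  have hε : 0 < ε := by positivity
  -- If L a < 0, θ a is eventually nonincreasing and R tends to 0. If L a = 0, the dichotomy gives R
  -- ≤ 1 while the advantage tends to 0. If L a > 0, the product is eventually nonnegative.
  have hlow : ∀ a ∈ Iᶜ, ∀ᶠ k in atTop, -ε ≤ R k a * adv k a := by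
    intro a ha
    rcases lt_trichotomy (L a) 0 with hneg | h0 | hL
    · have hbdd : ∃ M, ∀ᶠ k in atTop, θ k a ≤ M := by
        obtain ⟨K, hK⟩ := eventually_atTop.1 ((hlim a).eventually_lt_const hneg)
        refine ⟨θ K a, eventually_atTop.2 ⟨K, le_of_eventually_antitone
          (u := fun k => θ k a) fun k hk => ?_⟩⟩
        simp only [hstep k a]
        have : η k * (Real.exp (θ k a) / (∑ b, Real.exp (θ k b)) * adv k a) ≤ 0 :=
          mul_nonpos_of_nonneg_of_nonpos (hη0 k).le
            (mul_nonpos_of_nonneg_of_nonpos (hp k a) (hK k hk).le)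
        linarith
      obtain ⟨M, hM⟩ := hbdd
      have hRt : Tendsto (fun k => R k a) atTop (𝓝 0) := by
        refine Real.tendsto_exp_atBot.comp ?_
        refine tendsto_atBot_mono' _ (hM.mono fun k hk => sub_le_sub_right hk _)
          (tendsto_atBot_add_const_left _ M (tendsto_neg_atTop_atBot.comp htop))
      have := hRt.mul (hlim a)
      rw [zero_mul] at this
      exact (this.eventually_const_lt (neg_lt_zero.2 hε)).mono fun k hk => hk.le
    · have hle : ∀ᶠ k in atTop, θ k a ≤ θ k a₀ := by
        refine (hdich a (by rwa [h0])).resolve_right fun h => ?_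
        simp only [I, Finset.mem_compl, Finset.mem_filter, Finset.mem_univ, true_and] at ha
        exact ha ⟨h0, h⟩
      have h1 := hlim a
      rw [h0] at h1
      filter_upwards [hle, h1.eventually_const_lt (neg_lt_zero.2 hε)] with k hk hk'
      have hR1 : R k a ≤ 1 := Real.exp_le_one_iff.2 (sub_nonpos.2 hk)
      have hR0 : 0 ≤ R k a := (Real.exp_pos _).le
      nlinarith
    · filter_upwards [(hlim a).eventually_const_lt hL] with k hk
      have := mul_nonneg (Real.exp_pos (θ k a - θ k a₀)).le hk.le
      linarith
  have ha₀I : a₀ ∈ Iᶜ := by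
    simp only [I, Finset.mem_compl, Finset.mem_filter]
    exact fun h => hpos.ne' h.2.1
  have hneg : ∀ᶠ k in atTop, ∑ a ∈ I, R k a * adv k a < 0 := by
    filter_upwards [hadv₀, (eventually_all_finset _).2 hlow] with k hk hk'
    have h1 := Finset.sum_add_sum_compl I fun a => R k a * adv k a
    rw [hRsum k] at h1
    have h2 : ∑ a ∈ Iᶜ, (-ε + if a = a₀ then L a₀ / 2 else 0) ≤ ∑ a ∈ Iᶜ, R k a * adv k a := by
      refine Finset.sum_le_sum fun a ha => ?_
      split_ifs with h
      · subst h
        simp only [R, sub_self, Real.exp_zero, one_mul]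
        linarith
      · rw [add_zero]
        exact hk' a ha
    rw [Finset.sum_add_distrib, Finset.sum_ite_eq' , if_pos ha₀I, Finset.sum_const,
      nsmul_eq_mul] at h2
    have h3 : (Iᶜ.card : ℝ) * ε ≤ Fintype.card A * ε :=
      mul_le_mul_of_nonneg_right (by exact_mod_cast Finset.card_le_univ _) hε.le
    have h4 : Fintype.card A * ε = L a₀ / 4 := by
      unfold ε
      field_simp
    nlinarith
  obtain ⟨a₁, ha₁⟩ : I.Nonempty := by
    obtain ⟨k, hk⟩ := hneg.exists
    by_contra h
    rw [Finset.not_nonempty_iff_eq_empty.1 h] at hk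
    simp at hk
  have hIabove : ∀ᶠ k in atTop, ∀ a ∈ I, θ k a₀ < θ k a :=
    (eventually_all_finset _).2 fun a ha => (Finset.mem_filter.1 ha).2.2
  obtain ⟨K, hK⟩ := eventually_atTop.1 hneg
  -- The negative contribution of I makes its total parameter eventually nonincreasing, yet each
  -- parameter in I exceeds that of a₀, which diverges.
  have hdec := le_of_eventually_antitone (u := fun k => ∑ a ∈ I, θ k a) (K := K) fun k hk => by
    have h2 : ∑ a ∈ I, θ (k + 1) a = ∑ a ∈ I, θ k a +
        η k * (Real.exp (θ k a₀) / ∑ b, Real.exp (θ k b)) * ∑ a ∈ I, R k a * adv k a := by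
      rw [Finset.mul_sum, ← Finset.sum_add_distrib]
      refine Finset.sum_congr rfl fun a _ => ?_
      rw [hstep k a, hR k a]
      ring
    have h3 : η k * (Real.exp (θ k a₀) / ∑ b, Real.exp (θ k b)) *
        ∑ a ∈ I, R k a * adv k a ≤ 0 :=
      mul_nonpos_of_nonneg_of_nonpos (mul_nonneg (hη0 k).le (hp k a₀)) (hK k hk).le
    simp only [h2]
    linarith
  obtain ⟨k, hk1, hk2, hk3, hk4⟩ := (hIabove.and ((eventually_ge_atTop K).and
    ((htop.eventually_gt_atTop 0).and (htop.eventually_gt_atTop (∑ a ∈ I, θ K a))))).exists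
  have h1 := hdec k hk2
  have h2 : θ k a₁ ≤ ∑ a ∈ I, θ k a :=
    Finset.single_le_sum (f := fun a => θ k a) (fun a ha => (hk3.trans (hk1 a ha)).le) ha₁
  have h3 := hk1 a₁ ha₁
  linarith

/-- One softmax gradient step improves the expected advantage, for every step size. -/
lemma softmax_step_improvement [Nonempty A] {p adv : A → ℝ} {η B : ℝ} (hη : 0 ≤ η)
    (hp : ∀ a, 0 ≤ p a) (hp1 : ∑ a, p a = 1) (hB : ∀ a, |adv a| ≤ B)
    (hzero : ∑ a, p a * adv a = 0) :
    ∃ y, 0 ≤ y ∧ (∀ a, p a * adv a ≤ y) ∧ η * y ^ 2 / (1 + η * B) ≤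
      ∑ a, p a * Real.exp (η * (p a * adv a)) / (∑ b, p b * Real.exp (η * (p b * adv b))) *
        adv a := by
  obtain ⟨m, hm⟩ := Finite.exists_max fun a => p a * adv a
  set y := p m * adv m
  have hy0 : 0 ≤ y := by
    by_contra! h
    have : ∑ a, p a * adv a < 0 :=
      Finset.sum_neg (fun a _ => (hm a).trans_lt h) Finset.univ_nonempty
    linarith
  have hB0 : 0 ≤ B := (abs_nonneg _).trans (hB m)
  have hyB : y ≤ B := by
    have h1 : p m ≤ 1 := by
      rw [← hp1]
      exact Finset.single_le_sum (fun a _ => hp a) (Finset.mem_univ m)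
    calc y ≤ p m * |adv m| := mul_le_mul_of_nonneg_left (le_abs_self _) (hp m)
      _ ≤ 1 * B := mul_le_mul h1 (hB m) (abs_nonneg _) zero_le_one
      _ = B := one_mul B
  refine ⟨y, hy0, hm, ?_⟩
  set Z := ∑ b, p b * Real.exp (η * (p b * adv b))
  have hZpos : 0 < Z := by
    obtain ⟨a, -, ha⟩ : ∃ a ∈ Finset.univ, p a ≠ 0 :=
      Finset.exists_ne_zero_of_sum_ne_zero (by rw [hp1]; exact one_ne_zero)
    exact Finset.sum_pos' (fun b _ => mul_nonneg (hp b) (Real.exp_pos _).le)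
      ⟨a, Finset.mem_univ a, mul_pos (lt_of_le_of_ne (hp a) ha.symm) (Real.exp_pos _)⟩
  -- Bounding every exponent by the largest one is what keeps the estimate valid for arbitrarily
  -- large η.
  have hZle : Z ≤ Real.exp (η * y) := by
    calc Z ≤ ∑ b, p b * Real.exp (η * y) := Finset.sum_le_sum fun b _ =>
          mul_le_mul_of_nonneg_left
            (Real.exp_le_exp.2 (mul_le_mul_of_nonneg_left (hm b) hη)) (hp b)
      _ = _ := by rw [← Finset.sum_mul, hp1, one_mul]
  have hterm : ∀ x : ℝ, 0 ≤ x * (Real.exp (η * x) - 1) := by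
    intro x
    rcases le_total 0 x with hx | hx
    · exact mul_nonneg hx (sub_nonneg.2 (Real.one_le_exp (mul_nonneg hη hx)))
    · exact mul_nonneg_of_nonpos_of_nonpos hx
        (sub_nonpos.2 (Real.exp_le_one_iff.2 (mul_nonpos_of_nonneg_of_nonpos hη hx)))
  -- Zero mean allows 1 to be subtracted from each exponential; every term is then nonnegative and
  -- only the maximal one is kept.
  have hnum : y * (Real.exp (η * y) - 1) ≤
      ∑ a, p a * adv a * Real.exp (η * (p a * adv a)) := by
    have h1 := Finset.single_le_sum
      (f := fun a => p a * adv a * (Real.exp (η * (p a * adv a)) - 1))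
      (fun a _ => hterm _) (Finset.mem_univ m)
    simp only [mul_sub, mul_one, Finset.sum_sub_distrib, hzero, sub_zero] at h1 ⊢
    exact h1
  have hsum : ∑ a, p a * Real.exp (η * (p a * adv a)) / Z * adv a =
      (∑ a, p a * adv a * Real.exp (η * (p a * adv a))) / Z := by
    rw [Finset.sum_div]
    exact Finset.sum_congr rfl fun a _ => by ring
  rw [hsum, le_div_iff₀ hZpos]
  refine le_trans ?_ hnum
  have hηy : 0 ≤ η * y := mul_nonneg hη hy0
  have hden : 0 < 1 + η * B := by positivity
  -- Uses y ≤ B; the last inequality reduces to 1 + ηy ≤ exp(ηy).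
  calc η * y ^ 2 / (1 + η * B) * Z ≤ η * y ^ 2 / (1 + η * y) * Real.exp (η * y) := by
        gcongr
    _ ≤ y * (Real.exp (η * y) - 1) := by
        have h1 := Real.add_one_le_exp (η * y)
        rw [div_mul_eq_mul_div, div_le_iff₀ (by linarith)]
        nlinarith [mul_le_mul_of_nonneg_left h1 hy0]

end SoftmaxDynamics

lemma exists_pos_le_of_tendsto {u : ℕ → ℝ} {l : ℝ} (hu : ∀ k, 0 < u k) (hl : 0 < l)
    (h : Tendsto u atTop (𝓝 l)) : ∃ m, 0 < m ∧ ∀ k, m ≤ u k := by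
  obtain ⟨B, hB⟩ := (h.inv₀ hl.ne').bddAbove_range
  have hB' : ∀ k, (u k)⁻¹ ≤ B := fun k => hB ⟨k, rfl⟩
  have hB0 : 0 < B := (inv_pos.2 (hu 0)).trans_le (hB' 0)
  exact ⟨B⁻¹, inv_pos.2 hB0, fun k => inv_le_of_inv_le₀ (hu k) (hB' k)⟩

lemma stdSimplex_nonempty_index {X : Type*} [Fintype X] (p : stdSimplex ℝ X) : Nonempty X := by
  by_contra h
  rw [not_nonempty_iff] at h
  have := stdSimplex.sum_eq_one p
  simp at this

lemma iInf_stdSimplex_pos {X : Type*} [Fintype X] {p : stdSimplex ℝ X} (hp : ∀ x, 0 < p x) :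
    0 < ⨅ x, p x := by
  have := stdSimplex_nonempty_index p
  obtain ⟨x, hx⟩ := exists_eq_ciInf_of_finite (f := fun x => p x)
  rw [← hx]
  exact hp x

lemma iInf_stdSimplex_le {X : Type*} [Fintype X] (p : stdSimplex ℝ X) (x : X) :
    ⨅ x, p x ≤ p x :=
  ciInf_le (Set.finite_range _).bddBelow x

/-! ### Value gaps, non-optimal mass and convergence of the iterates. -/

namespace FiniteMDP

variable {S A : Type*} [Fintype S] [Fintype A] (M : FiniteMDP S A)

lemma one_sub_nonoptProb (π : Policy S A) (s : S) :
    1 - M.nonoptProb π s = ∑ a ∈ M.optActions s, π s a := by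
  classical
  rw [nonoptProb, ← stdSimplex.sum_eq_one (π s),
    ← Finset.sum_filter_add_sum_filter_not Finset.univ (fun a => a ∈ M.optActions s)]
  rw [Finset.filter_univ_mem]
  simp

lemma nonoptProb_nonneg (π : Policy S A) (s : S) : 0 ≤ M.nonoptProb π s :=
  Finset.sum_nonneg fun _ _ => stdSimplex.zero_le _ _

lemma kappa_le (π : ℕ → Policy S A) (k : ℕ) (s : S) : M.kappa π ≤ 1 - M.nonoptProb (π k) s :=
  ciInf_le (f := fun z : ℕ × S => 1 - M.nonoptProb (π z.1) z.2)
    ⟨0, by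
      rintro _ ⟨z, rfl⟩
      simp only [one_sub_nonoptProb]
      exact Finset.sum_nonneg fun _ _ => stdSimplex.zero_le _ _⟩ (k, s)

/-- The policy `π` conditioned on choosing optimal actions. -/
def restrictOpt (π : Policy S A) (hπ : ∀ s, 0 < ∑ a ∈ M.optActions s, π s a) : Policy S A :=
  fun s => ⟨fun a => open Classical in
      if a ∈ M.optActions s then π s a / ∑ b ∈ M.optActions s, π s b else 0,
    fun a => by
      dsimp only
      split_ifs
      · exact div_nonneg (stdSimplex.zero_le _ _) (hπ s).le
      · exact le_rfl, by
    classical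
    rw [← Finset.sum_filter, Finset.filter_univ_mem, ← Finset.sum_div]
    exact div_self (hπ s).ne'⟩

open Classical in
lemma restrictOpt_apply (π : Policy S A) (hπ : ∀ s, 0 < ∑ a ∈ M.optActions s, π s a) (s : S)
    (a : A) : M.restrictOpt π hπ s a =
      if a ∈ M.optActions s then π s a / ∑ b ∈ M.optActions s, π s b else 0 := rfl

lemma card_optActions_le (s : S) : (M.optActions s).card ≤ M.maxOptActions :=
  Finset.le_sup (f := fun s => (M.optActions s).card) (Finset.mem_univ s)

lemma VstarAvg_sub_nonneg (ρ : stdSimplex ℝ S) (π : Policy S A) :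
    0 ≤ M.VstarAvg ρ - M.Vavg ρ π := by
  rw [VstarAvg, Vavg, ← Finset.sum_sub_distrib]
  exact Finset.sum_nonneg fun s _ => by
    rw [← mul_sub]
    exact mul_nonneg (stdSimplex.zero_le _ _) (sub_nonneg.2 (M.V_le_Vstar π s))

variable [Nonempty A]

/-- The value gap at a state controls the probability of non-optimal actions. -/
lemma exists_mul_nonoptProb_le :
    ∃ Δ, 0 < Δ ∧ ∀ (π : Policy S A) (s : S), Δ * M.nonoptProb π s ≤ M.Vstar s - M.V π s := by
  classical
  -- Δ is the smallest suboptimality gap over the finitely many non-optimal pairs, or 1 when there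
  -- are none.
  obtain ⟨Δ, hΔ, hgap⟩ : ∃ Δ, 0 < Δ ∧ ∀ s, ∀ a ∉ M.optActions s, M.Astar s a ≤ -Δ := by
    set T := Finset.univ.filter fun z : S × A => z.2 ∉ M.optActions z.1
    rcases T.eq_empty_or_nonempty with hT | hT
    · refine ⟨1, one_pos, fun s a ha => ?_⟩
      have : (s, a) ∈ T := by simpa [T] using ha
      simp [hT] at this
    · obtain ⟨z, hz, hmax⟩ := T.exists_max_image (fun z => M.Astar z.1 z.2) hT
      refine ⟨-M.Astar z.1 z.2, ?_, fun s a ha => ?_⟩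
      · have h1 : z.2 ∉ M.optActions z.1 := by simpa [T] using hz
        have h2 := lt_of_le_of_ne (M.Astar_nonpos z.1 z.2) fun h => h1 (M.mem_optActions.2 h)
        linarith
      · rw [neg_neg]
        exact hmax (s, a) (by simpa [T] using ha)
  refine ⟨Δ, hΔ, fun π s => ?_⟩
  have h1 : M.V π s ≤ M.Vstar s + ∑ a, π s a * M.Astar s a := by
    rw [sum_policy_mul_Astar, V_eq_sum_Q]
    have := Finset.sum_le_sum fun a (_ : a ∈ Finset.univ) =>
      mul_le_mul_of_nonneg_left (M.Q_le_Qstar π s a) (stdSimplex.zero_le (π s) a)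
    linarith
  have h2 : ∑ a, π s a * M.Astar s a ≤ -(Δ * M.nonoptProb π s) := by
    rw [nonoptProb, Finset.mul_sum, ← Finset.sum_neg_distrib, Finset.sum_filter]
    refine Finset.sum_le_sum fun a _ => ?_
    split_ifs with ha
    · exact mul_nonpos_of_nonneg_of_nonpos (stdSimplex.zero_le _ _) (M.Astar_nonpos s a)
    · have := mul_le_mul_of_nonneg_left (hgap s a ha) (stdSimplex.zero_le (π s) a)
      linarith
  linarith

lemma restrictOpt_isOptimal (π : Policy S A) (hπ : ∀ s, 0 < ∑ a ∈ M.optActions s, π s a) :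
    M.IsOptimal (M.restrictOpt π hπ) :=
  M.isOptimal_iff.2 fun s a ha => by rw [restrictOpt_apply, if_neg ha]

/-- The value gap is controlled by the positive parts of `π(a|s) A^π(s,a)`. -/
lemma VstarAvg_sub_sq_le (ρ : stdSimplex ℝ S) {π : Policy S A} {κ D : ℝ} (hκ : 0 < κ)
    (hopt : ∀ s, κ ≤ ∑ a ∈ M.optActions s, π s a) (hD : ∀ πstar : Policy S A,
      M.IsOptimal πstar → ∀ s, M.visitation ρ πstar s ≤ D * ρ s) {y : S → ℝ} (hy : ∀ s, 0 ≤ y s)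
    (hπy : ∀ s a, π s a * (M.Q π s a - M.V π s) ≤ y s) :
    (M.VstarAvg ρ - M.Vavg ρ π) ^ 2 ≤
      (M.maxOptActions / (κ * (1 - M.γ))) ^ 2 * (D * ∑ s, ρ s * y s ^ 2) := by
  classical
  have hγ := M.one_sub_γ_pos
  have hπ : ∀ s, 0 < ∑ a ∈ M.optActions s, π s a := fun s => hκ.trans_le (hopt s)
  -- This comparator, unlike a fixed optimal policy, has weights at most π/κ, so the bound y on π
  -- times the advantage transfers action by action.
  set πs := M.restrictOpt π hπ
  have hπs : M.IsOptimal πs := M.restrictOpt_isOptimal π hπ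
  have hgap : M.VstarAvg ρ - M.Vavg ρ π = M.Vavg ρ πs - M.Vavg ρ π := by
    simp only [VstarAvg, Vavg, hπs _]
  have hstate : ∀ s, ∑ a, πs s a * (M.Q π s a - M.V π s) ≤ M.maxOptActions / κ * y s := by
    intro s
    have h1 : ∑ a, πs s a * (M.Q π s a - M.V π s) =
        (∑ a ∈ M.optActions s, π s a * (M.Q π s a - M.V π s)) /
          ∑ b ∈ M.optActions s, π s b := by
      simp only [πs, restrictOpt_apply, ite_mul, zero_mul]
      rw [← Finset.sum_filter, Finset.filter_univ_mem, Finset.sum_div]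
      exact Finset.sum_congr rfl fun a _ => by ring
    have h2 : ∑ a ∈ M.optActions s, π s a * (M.Q π s a - M.V π s) ≤ M.maxOptActions * y s := by
      refine (Finset.sum_le_card_nsmul _ _ (y s) fun a _ => hπy s a).trans ?_
      rw [nsmul_eq_mul]
      exact mul_le_mul_of_nonneg_right (by exact_mod_cast M.card_optActions_le s) (hy s)
    have h3 : 0 ≤ M.maxOptActions * y s := mul_nonneg (Nat.cast_nonneg _) (hy s)
    rw [h1, div_mul_eq_mul_div]
    exact div_le_div₀ h3 h2 hκ (hopt s)
  have hd : ∀ s, 0 ≤ M.visitation ρ πs s := M.visitation_nonneg ρ πs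
  have hle : M.VstarAvg ρ - M.Vavg ρ π ≤
      M.maxOptActions / (κ * (1 - M.γ)) * ∑ s, M.visitation ρ πs s * y s := by
    rw [hgap, Vavg_sub_Vavg]
    calc _ ≤ 1 / (1 - M.γ) * ∑ s, M.visitation ρ πs s * (M.maxOptActions / κ * y s) := by
          refine mul_le_mul_of_nonneg_left (Finset.sum_le_sum fun s _ => ?_) (by positivity)
          exact mul_le_mul_of_nonneg_left (hstate s) (hd s)
      _ = _ := by
          simp only [Finset.mul_sum]
          refine Finset.sum_congr rfl fun s _ => ?_
          field_simp
  -- Cauchy–Schwarz for the probability vector d_ρ, followed by the density bound d_ρ ≤ D ρ.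
  have hCS : (∑ s, M.visitation ρ πs s * y s) ^ 2 ≤ D * ∑ s, ρ s * y s ^ 2 := by
    have h1 := Finset.sum_sq_le_sum_mul_sum_of_sq_le_mul Finset.univ
      (r := fun s => M.visitation ρ πs s * y s) (f := fun s => M.visitation ρ πs s)
      (g := fun s => M.visitation ρ πs s * y s ^ 2) (fun s _ => hd s)
      (fun s _ => mul_nonneg (hd s) (sq_nonneg _))
      (fun s _ => le_of_eq (by ring))
    rw [sum_visitation, one_mul] at h1
    refine h1.trans ?_
    rw [Finset.mul_sum]
    refine Finset.sum_le_sum fun s _ => ?_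
    rw [← mul_assoc]
    exact mul_le_mul_of_nonneg_right (hD πs hπs s) (sq_nonneg _)
  calc _ ≤ (M.maxOptActions / (κ * (1 - M.γ)) * ∑ s, M.visitation ρ πs s * y s) ^ 2 :=
        pow_le_pow_left₀ (M.VstarAvg_sub_nonneg ρ π) hle 2
    _ = (M.maxOptActions / (κ * (1 - M.γ))) ^ 2 * (∑ s, M.visitation ρ πs s * y s) ^ 2 := by
        rw [mul_pow]
    _ ≤ _ := mul_le_mul_of_nonneg_left hCS (sq_nonneg _)

/-! ### Softmax policy gradient iterates -/

section Iterates

variable (μ : stdSimplex ℝ S) (η : ℝ) (θ₀ : EuclideanSpace ℝ (S × A))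

/-- The policies produced by softmax policy gradient. -/
def pgPolicy (k : ℕ) : Policy S A := softmaxPolicy (M.softmaxPG μ η θ₀ k)

/-- The effective step size at state `s` in iteration `k`. -/
def pgStep (k : ℕ) (s : S) : ℝ := η / (1 - M.γ) * M.visitation μ (M.pgPolicy μ η θ₀ k) s

lemma pgStep_mem_Icc (hη : 0 ≤ η) (k : ℕ) (s : S) :
    M.pgStep μ η θ₀ k s ∈ Set.Icc (η * ⨅ s, μ s) (η / (1 - M.γ)) := by
  have hγ := M.one_sub_γ_pos
  have h0 : 0 ≤ η / (1 - M.γ) := by positivity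
  constructor
  · calc η * ⨅ s, μ s ≤ η * μ s := mul_le_mul_of_nonneg_left (iInf_stdSimplex_le μ s) hη
      _ = η / (1 - M.γ) * ((1 - M.γ) * μ s) := by field_simp
      _ ≤ _ := mul_le_mul_of_nonneg_left (M.visitation_ge μ _ s) h0
  · exact mul_le_of_le_one_right h0 (M.visitation_le_one μ _ s)

/-- Adding to the parameters multiplies the weights; the old partition function cancels. This is the
form to which `softmax_step_improvement` applies. -/
lemma pgPolicy_succ (k : ℕ) (s : S) (a : A) :
    M.pgPolicy μ η θ₀ (k + 1) s a =
      M.pgPolicy μ η θ₀ k s a * Real.exp (M.pgStep μ η θ₀ k s * (M.pgPolicy μ η θ₀ k s a *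
        (M.Q (M.pgPolicy μ η θ₀ k) s a - M.V (M.pgPolicy μ η θ₀ k) s))) /
      ∑ b, M.pgPolicy μ η θ₀ k s b * Real.exp (M.pgStep μ η θ₀ k s * (M.pgPolicy μ η θ₀ k s b *
        (M.Q (M.pgPolicy μ η θ₀ k) s b - M.V (M.pgPolicy μ η θ₀ k) s))) := by
  have hθ : ∀ b, Real.exp (M.softmaxPG μ η θ₀ (k + 1) (s, b)) =
      (∑ b, Real.exp (M.softmaxPG μ η θ₀ k (s, b))) * (M.pgPolicy μ η θ₀ k s b *
        Real.exp (M.pgStep μ η θ₀ k s * (M.pgPolicy μ η θ₀ k s b *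
          (M.Q (M.pgPolicy μ η θ₀ k) s b - M.V (M.pgPolicy μ η θ₀ k) s)))) := by
    intro b
    have h : (∑ b, Real.exp (M.softmaxPG μ η θ₀ k (s, b))) * M.pgPolicy μ η θ₀ k s b =
        Real.exp (M.softmaxPG μ η θ₀ k (s, b)) := by
      rw [pgPolicy, softmaxPolicy_apply, mul_div_cancel₀ _ (sum_exp_pos _ s).ne']
    rw [← mul_assoc (∑ b, _), h, softmaxPG_succ, Real.exp_add]
    rfl
  conv_lhs => rw [pgPolicy, softmaxPolicy_apply]
  simp only [hθ, ← Finset.mul_sum]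
  rw [mul_div_mul_left _ _ (sum_exp_pos _ s).ne']

variable {μ η}

/-- Quantitative policy improvement for softmax policy gradient with any step size. -/
lemma exists_improvement (hμ : ∀ s, 0 < μ s) (hη : 0 < η) (k : ℕ) :
    ∃ y : S → ℝ, (∀ s, 0 ≤ y s) ∧
      (∀ s a, M.pgPolicy μ η θ₀ k s a *
        (M.Q (M.pgPolicy μ η θ₀ k) s a - M.V (M.pgPolicy μ η θ₀ k) s) ≤ y s) ∧
      ∀ s, (1 - M.γ) / (1 + (1 - M.γ) / (η * ⨅ s, μ s)) * y s ^ 2 ≤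
        M.V (M.pgPolicy μ η θ₀ (k + 1)) s - M.V (M.pgPolicy μ η θ₀ k) s := by
  have hγ := M.one_sub_γ_pos
  have he : 0 < η * ⨅ s, μ s := mul_pos hη (iInf_stdSimplex_pos hμ)
  have hh : ∀ s, 0 < M.pgStep μ η θ₀ k s := fun s =>
    he.trans_le (M.pgStep_mem_Icc μ η θ₀ hη.le k s).1
  choose y hy0 hy himp using fun s => softmax_step_improvement (hh s).le
    (fun a => stdSimplex.zero_le (M.pgPolicy μ η θ₀ k s) a) (stdSimplex.sum_eq_one _)
    (M.abs_advantage_le (M.pgPolicy μ η θ₀ k) s)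
    (M.sum_policy_mul_advantage (M.pgPolicy μ η θ₀ k) s)
  simp only [← pgPolicy_succ] at himp
  have hbound : ∀ s, (1 - M.γ) / (1 + (1 - M.γ) / (η * ⨅ s, μ s)) * y s ^ 2 ≤
      ∑ a, M.pgPolicy μ η θ₀ (k + 1) s a *
        (M.Q (M.pgPolicy μ η θ₀ k) s a - M.V (M.pgPolicy μ η θ₀ k) s) := by
    intro s
    refine le_trans ?_ (himp s)
    rw [mul_div_right_comm]
    refine mul_le_mul_of_nonneg_right ?_ (sq_nonneg _)
    have h1 := (M.pgStep_mem_Icc μ η θ₀ hη.le k s).1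
    -- In this form the coefficient is visibly increasing in the effective step, which may be
    -- replaced by its lower bound η min μ.
    have h2 : ∀ x : ℝ, 0 < x → x / (1 + x * (1 / (1 - M.γ))) = (1 - M.γ) / (1 + (1 - M.γ) / x) :=
      fun x hx => by
        field_simp
        ring
    rw [h2 _ (hh s)]
    have := hh s
    gcongr
  refine ⟨y, hy0, hy, fun s => (hbound s).trans ?_⟩
  rw [V_sub_V]
  exact le_chainValue _ M.γ_mem (g := fun s => ∑ a, M.pgPolicy μ η θ₀ (k + 1) s a *
    (M.Q (M.pgPolicy μ η θ₀ k) s a - M.V (M.pgPolicy μ η θ₀ k) s))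
    (fun s => le_trans (by positivity) (hbound s)) s

lemma monotone_V_pgPolicy (hμ : ∀ s, 0 < μ s) (hη : 0 < η) (s : S) :
    Monotone fun k => M.V (M.pgPolicy μ η θ₀ k) s := by
  refine monotone_nat_of_le_succ fun k => ?_
  obtain ⟨y, -, -, hy⟩ := M.exists_improvement θ₀ hμ hη k
  have hγ := M.one_sub_γ_pos
  have he : 0 < η * ⨅ s, μ s := mul_pos hη (iInf_stdSimplex_pos hμ)
  have : 0 ≤ (1 - M.γ) / (1 + (1 - M.γ) / (η * ⨅ s, μ s)) * y s ^ 2 := by positivity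
  linarith [hy s]

/-- Global convergence of softmax policy gradient with any constant step size. -/
theorem tendsto_V_pgPolicy (hμ : ∀ s, 0 < μ s) (hη : 0 < η) (s : S) :
    Tendsto (fun k => M.V (M.pgPolicy μ η θ₀ k) s) atTop (𝓝 (M.Vstar s)) := by
  have hlim : ∀ s, ∃ v, Tendsto (fun k => M.V (M.pgPolicy μ η θ₀ k) s) atTop (𝓝 v) := fun s =>
    ⟨_, tendsto_atTop_ciSup (M.monotone_V_pgPolicy θ₀ hμ hη s)
      ⟨_, by rintro _ ⟨k, rfl⟩; exact M.V_le_Vstar _ s⟩⟩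
  choose v hv using hlim
  have hQ : ∀ s a, Tendsto (fun k => M.Q (M.pgPolicy μ η θ₀ k) s a) atTop
      (𝓝 (M.r s a + M.γ * ∑ s', M.P s a s' * v s')) := fun s a => by
    simp only [Q_eq]
    exact tendsto_const_nhds.add (tendsto_const_nhds.mul
      (tendsto_finsetSum _ fun s' _ => tendsto_const_nhds.mul (hv s')))
  have hle : ∀ s a, M.r s a + M.γ * ∑ s', M.P s a s' * v s' - v s ≤ 0 := fun s a =>
    softmax_dynamics_limit_nonpos (θ := fun k a => M.softmaxPG μ η θ₀ k (s, a))
      (adv := fun k a => M.Q (M.pgPolicy μ η θ₀ k) s a - M.V (M.pgPolicy μ η θ₀ k) s)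
      (η := fun k => M.pgStep μ η θ₀ k s) (L := fun a =>
        M.r s a + M.γ * ∑ s', M.P s a s' * v s' - v s)
      (mul_pos hη (iInf_stdSimplex_pos hμ)) (fun k => M.pgStep_mem_Icc μ η θ₀ hη.le k s)
      (fun k a => M.abs_advantage_le (M.pgPolicy μ η θ₀ k) s a)
      (fun k a => M.softmaxPG_succ μ η θ₀ k s a)
      (fun k => M.sum_policy_mul_advantage (M.pgPolicy μ η θ₀ k) s)
      (fun a => (hQ s a).sub (hv s)) a
  -- By `hle` the limit v satisfies the Bellman optimality inequality, so v − V^π dominates its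
  -- discounted one-step expectation.
  have hdom : ∀ (π : Policy S A) (s : S), M.V π s ≤ v s := by
    intro π s
    refine sub_nonneg.1 (nonneg_of_chainOp_le (M.policyKernel π) M.γ_mem
      (u := fun s => v s - M.V π s) (fun s => ?_) s)
    have h1 : ∑ a, π s a * (M.r s a + M.γ * ∑ s', M.P s a s' * v s') ≤ v s := by
      calc _ ≤ ∑ a, π s a * v s := Finset.sum_le_sum fun a _ =>
            mul_le_mul_of_nonneg_left (sub_nonpos.1 (hle s a)) (stdSimplex.zero_le _ _)
        _ = v s := by rw [← Finset.sum_mul, stdSimplex.sum_eq_one, one_mul]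
    have h2 : M.γ * chainOp (M.policyKernel π) (fun s => v s - M.V π s) s =
        ∑ a, π s a * (M.r s a + M.γ * ∑ s', M.P s a s' * v s') - M.V π s := by
      rw [V_eq_sum_Q, ← Finset.sum_sub_distrib, chainOp_policyKernel, Finset.mul_sum]
      refine Finset.sum_congr rfl fun a _ => ?_
      rw [Q_eq]
      simp only [mul_sub, Finset.sum_sub_distrib]
      ring
    linarith
  have heq : v s = M.Vstar s :=
    le_antisymm (le_of_tendsto' (hv s) fun k => M.V_le_Vstar _ s)
      (ciSup_le fun π => hdom π s)
  exact heq ▸ hv s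

/-- Softmax weights are positive, and convergence to V^* drives the non-optimal mass to 0; a
positive sequence with limit 1 is bounded away from 0, uniformly over finitely many states. -/
lemma kappa_pgPolicy_pos (hμ : ∀ s, 0 < μ s) (hη : 0 < η) :
    0 < M.kappa (M.pgPolicy μ η θ₀) := by
  obtain ⟨Δ, hΔ, hgap⟩ := M.exists_mul_nonoptProb_le
  have hS := stdSimplex_nonempty_index μ
  have hpos : ∀ k s, 0 < 1 - M.nonoptProb (M.pgPolicy μ η θ₀ k) s := fun k s => by
    rw [one_sub_nonoptProb]
    exact Finset.sum_pos (fun a _ => softmaxPolicy_pos _ s a) (M.optActions_nonempty s)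
  have hlim : ∀ s, Tendsto (fun k => 1 - M.nonoptProb (M.pgPolicy μ η θ₀ k) s) atTop (𝓝 1) := by
    intro s
    have h1 : Tendsto (fun k => (M.Vstar s - M.V (M.pgPolicy μ η θ₀ k) s) / Δ) atTop (𝓝 0) := by
      have := ((M.tendsto_V_pgPolicy θ₀ hμ hη s).const_sub (M.Vstar s)).div_const Δ
      simpa using this
    have h2 : Tendsto (fun k => M.nonoptProb (M.pgPolicy μ η θ₀ k) s) atTop (𝓝 0) :=
      squeeze_zero (fun k => M.nonoptProb_nonneg _ s)
        (fun k => (le_div_iff₀' hΔ).2 (hgap _ s)) h1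
    simpa using h2.const_sub 1
  choose m hm0 hm using fun s => exists_pos_le_of_tendsto (fun k => hpos k s) one_pos (hlim s)
  obtain ⟨s₀, hs₀⟩ := Finite.exists_min m
  exact (hm0 s₀).trans_le (le_ciInf fun z => (hs₀ z.2).trans (hm z.2 z.1))

/-- Sublinear convergence, with `D` any bound for the densities `d_ρ^{π*} / ρ`. -/
theorem VstarAvg_sub_le (hμ : ∀ s, 0 < μ s) (hη : 0 < η) (ρ : stdSimplex ℝ S) {D : ℝ}
    (hD0 : 0 < D) (hD : ∀ πstar : Policy S A, M.IsOptimal πstar →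
      ∀ s, M.visitation ρ πstar s ≤ D * ρ s) {k : ℕ} (hk : 1 ≤ k) :
    M.VstarAvg ρ - M.Vavg ρ (M.pgPolicy μ η θ₀ k) ≤
      1 / (k : ℝ) * (1 / (1 - M.γ) ^ 3) *
        ((Fintype.card A : ℝ) / M.kappa (M.pgPolicy μ η θ₀) ^ 2) * D *
        (M.maxOptActions : ℝ) ^ 2 * (1 + (1 - M.γ) / (η * ⨅ s, μ s)) := by
  have hγ := M.one_sub_γ_pos
  have hκ := M.kappa_pgPolicy_pos θ₀ hμ hη
  set κ := M.kappa (M.pgPolicy μ η θ₀)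
  have he : 0 < η * ⨅ s, μ s := mul_pos hη (iInf_stdSimplex_pos hμ)
  obtain ⟨s₀⟩ := stdSimplex_nonempty_index μ
  have hN : (0 : ℝ) < M.maxOptActions := by
    exact_mod_cast (M.optActions_nonempty s₀).card_pos.trans_le (M.card_optActions_le s₀)
  set N : ℝ := (M.maxOptActions : ℝ)
  set E := 1 + (1 - M.γ) / (η * ⨅ s, μ s)
  have hE : 0 < E := by positivity
  -- Ratio of the improvement coefficient to the gap coefficient: the improvement is at least c
  -- times the squared gap.
  set c := (1 - M.γ) / E / ((N / (κ * (1 - M.γ))) ^ 2 * D)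
  have hc : 0 < c := by positivity
  have hrec : ∀ k, M.VstarAvg ρ - M.Vavg ρ (M.pgPolicy μ η θ₀ (k + 1)) ≤
      M.VstarAvg ρ - M.Vavg ρ (M.pgPolicy μ η θ₀ k) -
        c * (M.VstarAvg ρ - M.Vavg ρ (M.pgPolicy μ η θ₀ k)) ^ 2 := by
    intro k
    obtain ⟨y, hy0, hy, himp⟩ := M.exists_improvement θ₀ hμ hη k
    have h1 := M.VstarAvg_sub_sq_le ρ hκ
      (fun s => (M.kappa_le (M.pgPolicy μ η θ₀) k s).trans_eq (M.one_sub_nonoptProb _ s)) hD hy0 hy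
    have h2 : (1 - M.γ) / E * ∑ s, ρ s * y s ^ 2 ≤
        M.Vavg ρ (M.pgPolicy μ η θ₀ (k + 1)) - M.Vavg ρ (M.pgPolicy μ η θ₀ k) := by
      simp only [Vavg]
      rw [← Finset.sum_sub_distrib, Finset.mul_sum]
      refine Finset.sum_le_sum fun s _ => ?_
      have := mul_le_mul_of_nonneg_left (himp s) (stdSimplex.zero_le ρ s)
      linarith
    have h3 : c * (M.VstarAvg ρ - M.Vavg ρ (M.pgPolicy μ η θ₀ k)) ^ 2 ≤
        (1 - M.γ) / E * ∑ s, ρ s * y s ^ 2 := by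
      calc _ ≤ c * ((N / (κ * (1 - M.γ))) ^ 2 * (D * ∑ s, ρ s * y s ^ 2)) :=
            mul_le_mul_of_nonneg_left h1 hc.le
        _ = (1 - M.γ) / E * ∑ s, ρ s * y s ^ 2 := by
            simp only [c]
            field_simp
    linarith
  have hrate := mul_le_one_of_le_sub_mul_sq hc.le (fun k => M.VstarAvg_sub_nonneg ρ _) hrec k
  have hk0 : (0 : ℝ) < k := by exact_mod_cast hk
  -- The bound 1/(ck) contains no factor |A|; it enters only by weakening 1 to |A|.
  have hA : (1 : ℝ) ≤ Fintype.card A := by exact_mod_cast Fintype.card_pos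
  calc M.VstarAvg ρ - M.Vavg ρ (M.pgPolicy μ η θ₀ k) ≤ 1 / (c * k) := by
        rw [le_div_iff₀ (by positivity)]
        linarith
    _ = 1 / (k : ℝ) * (1 / (1 - M.γ) ^ 3) * (1 / κ ^ 2) * D * N ^ 2 * E := by
        simp only [c]
        field_simp
    _ ≤ _ := by gcongr

end Iterates

end FiniteMDP

end

theorem theorem4p5 {S A : Type*} [Fintype S] [Fintype A] [Nonempty A]
    (M : FiniteMDP S A) (μ ρ : stdSimplex ℝ S) (hμ : ∀ s, 0 < μ s) (hρ : ∀ s, 0 < ρ s)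
    (η : ℝ) (hη : 0 < η) (θ₀ : EuclideanSpace ℝ (S × A))
    (π : ℕ → Policy S A) (hπ : ∀ k, π k = softmaxPolicy (M.softmaxPG μ η θ₀ k))
    (κ : ℝ) (hκ : κ = M.kappa π) :
    0 < κ ∧
    (∀ k : ℕ, 1 ≤ k →
      M.VstarAvg ρ - M.Vavg ρ (π k) ≤
        1 / (k : ℝ) * (1 / ((⨅ s, ρ s) * (1 - M.γ) ^ 3)) * ((Fintype.card A : ℝ) / κ ^ 2) *
          (M.maxOptActions : ℝ) ^ 2 * (1 + (1 - M.γ) / (η * ⨅ s, μ s))) ∧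
    ((∃! πstar : Policy S A, M.IsOptimal πstar) ↔ ∀ s, (M.optActions s).card = 1) ∧
    (∀ πstar : Policy S A, M.IsOptimal πstar → (∀ π', M.IsOptimal π' → π' = πstar) →
      ∀ k : ℕ, 1 ≤ k →
        M.VstarAvg ρ - M.Vavg ρ (π k) ≤
          1 / (k : ℝ) * (1 / (1 - M.γ) ^ 3) * ((Fintype.card A : ℝ) / κ ^ 2) *
            ‖fun s => M.visitation ρ πstar s / ρ s‖ * (1 + (1 - M.γ) / (η * ⨅ s, μ s))) := by
  obtain rfl : π = M.pgPolicy μ η θ₀ := funext hπ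
  subst hκ
  have hS := stdSimplex_nonempty_index μ
  have hρ0 := iInf_stdSimplex_pos hρ
  refine ⟨M.kappa_pgPolicy_pos θ₀ hμ hη, fun k hk => ?_, M.existsUnique_isOptimal_iff,
    fun πstar hopt huniq k hk => ?_⟩
  -- Since d_ρ ≤ 1, the density d_ρ/ρ of any policy is at most 1/min ρ.
  · refine (M.VstarAvg_sub_le θ₀ hμ hη ρ (D := 1 / ⨅ s, ρ s) (by positivity)
      (fun πstar _ s => (M.visitation_le_one ρ πstar s).trans ?_) hk).trans_eq ?_
    · rw [div_mul_eq_mul_div, one_mul, one_le_div hρ0]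
      exact iInf_stdSimplex_le ρ s
    · rw [one_div_mul_eq_div]
      field_simp
  · have hdens : ∀ s, M.visitation ρ πstar s / ρ s ≤
        ‖fun s => M.visitation ρ πstar s / ρ s‖ := fun s =>
      (le_abs_self _).trans (norm_le_pi_norm (fun s => M.visitation ρ πstar s / ρ s) s)
    -- Here D is the sup norm of the density of the only optimal policy, positive because d_ρ ≥
    -- (1−γ)ρ > 0.
    have hD0 : 0 < ‖fun s => M.visitation ρ πstar s / ρ s‖ := by
      obtain ⟨s⟩ := hS
      exact (div_pos ((mul_pos M.one_sub_γ_pos (hρ s)).trans_le (M.visitation_ge ρ πstar s))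
        (hρ s)).trans_le (hdens s)
    have hcard := M.existsUnique_isOptimal_iff.1 ⟨πstar, hopt, huniq⟩
    have hN : M.maxOptActions = 1 := by
      simp only [FiniteMDP.maxOptActions, hcard]
      exact Finset.sup_const Finset.univ_nonempty 1
    have := M.VstarAvg_sub_le θ₀ hμ hη ρ hD0 (fun π' hπ' s => by
      rw [huniq π' hπ']
      exact (div_le_iff₀ (hρ s)).1 (hdens s)) hk
    rwa [hN, Nat.cast_one, one_pow, mul_one] at this
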